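/- **Setting.** A resource $\Psi$ is a family of multi-qubit pure states; write $N$ for the number of qubits of $|\psi\rangle\in\Psi$. An LOCC protocol on $N$ qubits consists of finitely many rounds; in each round every qubit undergoes a single-qubit instrument (finitely many Kraus operators $K_o$ with $\sum_o K_o^\dagger K_o=1$), all outcomes are broadcast, and later instruments may depend on them. For an $N$-qubit state $\psi$, an $n$-qubit state $\phi$ ($n\le N$) and an $n$-element set $A$ of qubits (labelled in some order by the qubits of $\phi$), the transformation $|\psi\rangle\to|\phi\rangle^A|0\rangle^{\bar A}$ is possible by LOCC if some protocol produces $|\phi\rangle^A|0\rangle^{\bar A}$, up to a scalar, in every branch. $\Psi$ is an *efficient universal resource* if for every family $\{|\phi^{(n)}\rangle\}_{n\ge1}$ of $n$-qubit states produced from $|0\rangle^{\otimes n}$ by circuits of $\mathrm{poly}(n)$ gates (CNOT and arbitrary $SU(2)$ gates) there is a polynomial $p$ such that for every $n\ge1$ some $|\psi\rangle\in\Psi$ on $N\le p(n)$ qubits can be transformed by LOCC into $|\phi^{(n)}\rangle^A|0\rangle^{\bar A}$ for some $A$, in polynomial time and with polynomially bounded classical side-processing: at most $p(n)$ rounds,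 instruments taken from a table of at most $p(n)$ instruments with at most $p(n)$ outcomes each, the table entry used on each qubit in each round being computed from the earlier outcomes by a Boolean circuit with at most $p(n)$ gates. $\Psi$ is *spatially efficient universal* if the same holds with $N\le p(n)$ but with no bound on rounds, instruments and side-processing. **Measures** of an $N$-qubit state $\psi$. For a set $A$ of qubits let $\rho_A=\mathrm{Tr}_{\bar A}|\psi\rangle\langle\psi|$, $E_{A}(\psi)=-\mathrm{Tr}(\rho_A\log_2\rho_A)$ and $\chi_{A}(\psi)=\operatorname{rank}\rho_A$. A subcubic tree is a finite tree all of whose vertices have degree 1 or 3; here its leaves are identified with the $N$ qubits. Deleting an edge $e$ of $T$ splits the qubits into $A_T^e$ and its complement. * Entropic entanglement width: $E_{\mathrm{wd}}(\psi)=\min_T\max_{e\in T}E_{A_T^e}(\psi)$; Schmidt-rank width: $\chi_{\mathrm{wd}}(\psi)=\min_T\max_{e\in T}\log_2\chi_{A_T^e}(\psi)$ (both $0$ if $N\le1$). * $\mathcal N_{\mathrm{LE}}(\psi)$: the largest size of a set of qubits such that for any two distinct elements $\alpha,\beta$ a Bell pair $(|00\rangle+|11\rangle)/\sqrt2$ on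 $\alpha,\beta$ (with $|0\rangle$ on all other qubits) can be obtained from $\psi$ by LOCC with unit probability. * Geometric measure: $E_g(\psi)=-\log_2\max|\langle\psi|\varphi\rangle|^2$, the maximum being over complete product states $\varphi=\varphi_1\otimes\dots\otimes\varphi_N$. * Schmidt measure: $E_s(\psi)=\log_2 K$, with $K$ the least number of complete product states of which $\psi$ is a linear combination. A measure $E$ *scales at most logarithmically* on $\Psi$ if there are $C$ and $N_0$ with $E(\psi)\le C\log N$ for all $\psi\in\Psi$ on $N\ge N_0$ qubits. **Theorem.** Let $\Psi$ be a resource. If one of $E_{\mathrm{wd}}$, $\chi_{\mathrm{wd}}$, $\mathcal N_{\mathrm{LE}}$, $E_g$, $E_s$ scales at most logarithmically with the system size on $\Psi$, then $\Psi$ is not an efficient universal resource; it is not even spatially efficient universal. In particular, the same conclusion holds in the following two cases. 1. The states of $\Psi$ are states of qubit chains (such as ground states of critical one-dimensional spin systems) for which there is a constant $C$ such that $E_A(\psi)\le C\log L$ for every $\psi\in\Psi$ and every subchain $A$ of $L\ge2$ consecutive qubits of $\psi$. 2. $\Psi=\{|W_N\rangle : N\ge1\}$, where $|W_N\rangle=N^{-1/2}\sum_{i=1}^N|e_{N,i}\rangle$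 and $e_{N,i}$ is the bit string with its only $1$ at position $i$. -/

import Mathlib

open scoped Matrix

noncomputable section

namespace MQC

/-! ### States -/

/-- Vectors of the `N`-qubit Hilbert space, written in the computational basis. -/
abbrev Vec (N : ℕ) : Type := EuclideanSpace ℂ (Fin N → Fin 2)

/-- Pure `N`-qubit states: unit vectors. -/
def QState (N : ℕ) : Type := {v : Vec N // ‖v‖ = 1}

/-- Normalised single-qubit states. -/
def Qubit : Type := {v : EuclideanSpace ℂ (Fin 2) // ‖v‖ = 1}

/-- The complete product vector `α₁ ⊗ ⋯ ⊗ α_N`. -/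
def productVec {N : ℕ} (α : Fin N → Qubit) : Vec N :=
  WithLp.toLp 2 (fun x => ∏ j, (α j).1 (x j))

/-- `|0⟩^{⊗ n}`. -/
def zeroVec (n : ℕ) : Vec n := EuclideanSpace.single (fun _ => 0) 1

/-- The Bell vector `(|00⟩ + |11⟩)/√2`. -/
def bellVec : Vec 2 :=
  ((Real.sqrt 2 : ℂ)⁻¹) • (EuclideanSpace.single ![0, 0] 1 + EuclideanSpace.single ![1, 1] 1)

/-- `|φ⟩^A |0⟩^{Ā}`, where the `k`-th qubit of `φ` is placed on qubit `f k`, and `A` is the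
range of `f`. -/
def placeVec {n N : ℕ} (f : Fin n ↪ Fin N) (φ : Vec n) : Vec N :=
  open scoped Classical in
  WithLp.toLp 2 (fun x => if ∀ j, j ∉ Set.range f → x j = 0 then φ (fun k => x (f k)) else 0)

/-- The computational basis string with a single `1`, at position `i`. -/
def oneHot {N : ℕ} (i : Fin N) : Fin N → Fin 2 := Pi.single i 1

theorem oneHot_injective {N : ℕ} : Function.Injective (oneHot (N := N)) := by
  intro i j h
  by_contra hij
  have := congrFun h i
  simp [oneHot, hij] at this

/-- The vector of the `N`-qubit W state. -/
def wVec (N : ℕ) : Vec N :=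
  ((Real.sqrt N : ℂ)⁻¹) • ∑ i : Fin N, EuclideanSpace.single (oneHot i) 1

theorem norm_wVec {N : ℕ} (hN : 1 ≤ N) : ‖wVec N‖ = 1 := by
  have hon : Orthonormal ℂ
      (fun i : Fin N => (EuclideanSpace.single (oneHot i) 1 : Vec N)) :=
    (EuclideanSpace.orthonormal_single (𝕜 := ℂ) (ι := Fin N → Fin 2)).comp _ oneHot_injective
  have h1 : inner ℂ (∑ i : Fin N, (EuclideanSpace.single (oneHot i) 1 : Vec N))
      (∑ i : Fin N, (EuclideanSpace.single (oneHot i) 1 : Vec N)) = (N : ℂ) := by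
    have := hon.inner_sum (fun _ => (1 : ℂ)) (fun _ => (1 : ℂ)) Finset.univ
    simpa using this
  have h2 : ‖(∑ i : Fin N, (EuclideanSpace.single (oneHot i) 1 : Vec N))‖ ^ 2 = (N : ℝ) := by
    have h := inner_self_eq_norm_sq_to_K (𝕜 := ℂ)
      (∑ i : Fin N, (EuclideanSpace.single (oneHot i) 1 : Vec N))
    rw [h1] at h
    apply Complex.ofReal_injective
    push_cast
    simpa using h.symm
  have h3 : ‖(∑ i : Fin N, (EuclideanSpace.single (oneHot i) 1 : Vec N))‖ = Real.sqrt N := by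
    rw [← h2, Real.sqrt_sq (norm_nonneg _)]
  have hpos : (0 : ℝ) < Real.sqrt N := Real.sqrt_pos.mpr (by exact_mod_cast hN)
  rw [wVec, norm_smul, h3, norm_inv, Complex.norm_real, Real.norm_eq_abs, abs_of_pos hpos]
  exact inv_mul_cancel₀ hpos.ne'

/-- The W state `N^{-1/2} ∑ᵢ |e_{N,i}⟩`. -/
def wState (N : ℕ) (hN : 1 ≤ N) : QState N := ⟨wVec N, norm_wVec hN⟩

/-- A resource: a family of multi-qubit states of (possibly) different sizes. -/
abbrev Resource : Type := Set (Σ N : ℕ, QState N)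

/-- The resource of all W states. -/
def wResource : Resource := {s | ∃ (N : ℕ) (hN : 1 ≤ N), s = ⟨N, wState N hN⟩}

/-! ### Local operations and classical communication -/

/-- The tensor product `M₁ ⊗ ⋯ ⊗ M_N` of single-qubit operators, acting on a vector. -/
def applyLocal {N : ℕ} (M : Fin N → Matrix (Fin 2) (Fin 2) ℂ) (v : Vec N) : Vec N :=
  WithLp.toLp 2 (fun x => ∑ y, (∏ j, M j (x j) (y j)) * v y)

/-- A single-qubit generalised measurement with `m` outcomes, given by its Kraus operators.
(Unitaries, resets and channels are special cases.) -/
structure Instrument (m : ℕ) where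
  kraus : Fin m → Matrix (Fin 2) (Fin 2) ℂ
  complete : ∑ o, (kraus o)ᴴ * kraus o = 1

/-- LOCC protocols on `N` qubits with finitely many rounds. In each round every qubit is
subjected to a local instrument (possibly the trivial one), all outcomes are broadcast, and the
continuation depends on the outcomes. -/
inductive Protocol (N : ℕ) : Type
  | done : Protocol N
  | round (m : ℕ) (I : Fin N → Instrument m) (next : (Fin N → Fin m) → Protocol N) : Protocol N

/-- The protocol turns `v` into `t` with unit probability: in every branch the resulting
(unnormalised) vector is a multiple of `t`; the branches of probability zero are those with
vanishing final vector. -/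
def Protocol.Transforms {N : ℕ} : Protocol N → Vec N → Vec N → Prop
  | .done, v, t => ∃ c : ℂ, v = c • t
  | .round _ I next, v, t =>
      ∀ o, (next o).Transforms (applyLocal (fun j => (I j).kraus (o j)) v) t

/-- `|ψ⟩ → |φ⟩^A |0⟩^{Ā}` is possible by LOCC with unit probability, `A` being the range
of `f`. -/
def ConvertibleOn {n N : ℕ} (f : Fin n ↪ Fin N) (ψ : Vec N) (φ : Vec n) : Prop :=
  ∃ P : Protocol N, P.Transforms ψ (placeVec f φ)

/-! ### Quantum circuits -/

/-- Elementary gates: single-qubit gates from `SU(2)` and CNOT. -/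
inductive Gate (n : ℕ) : Type
  | single (j : Fin n) (U : Matrix.specialUnitaryGroup (Fin 2) ℂ) : Gate n
  | cnot (control target : Fin n) (h : control ≠ target) : Gate n

def Gate.apply {n : ℕ} : Gate n → Vec n → Vec n
  | .single j U, v => applyLocal (Function.update (fun _ => 1) j U.1) v
  | .cnot c t _, v => WithLp.toLp 2 (fun x => v (Function.update x t (x t + x c)))

/-- The output of a circuit (a list of gates, in the order of application) on `|0⟩^{⊗ n}`. -/
def circuitOutput {n : ℕ} (gates : List (Gate n)) : Vec n :=
  gates.foldl (fun v g => g.apply v) (zeroVec n)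

/-- The family `φ⁽ⁿ⁾`, `n ≥ 1`, is generated by a polynomial-size family of circuits. -/
def PolyPreparable (φ : ∀ n : ℕ, QState n) : Prop :=
  ∃ p : Polynomial ℕ, ∀ n, 1 ≤ n →
    ∃ gates : List (Gate n), gates.length ≤ p.eval n ∧ (φ n).1 = circuitOutput gates

/-! ### LOCC with bounded time and bounded classical side-processing -/

/-- Evaluation of a Boolean NAND circuit: the wires start with the input bits, and each gate
appends the NAND of two wires (a wire that does not exist carries `false`). -/
def nandEval (gates : List (ℕ × ℕ)) (input : List Bool) : List Bool :=
  gates.foldl (fun w g => w ++ [!(w.getD g.1 false && w.getD g.2 false)]) input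

/-- One-hot encoding of the outcomes of all previous rounds as a bit string. -/
def encodeHistory {N m : ℕ} (h : List (Fin N → Fin m)) : List Bool :=
  h.flatMap fun o => (List.finRange N).flatMap fun j =>
    (List.finRange m).map fun i => decide (o j = i)

/-- An LOCC protocol controlled by a classical computation. There is a finite table of local
instruments; in round `t` a Boolean circuit reads the outcomes of all earlier rounds and
determines which entry of the table is applied to which qubit. -/
structure Program (N : ℕ) where
  rounds : ℕ
  outcomes : ℕ
  tableSize : ℕ
  table : Fin (tableSize + 1) → Instrument outcomes
  control : ℕ → List (ℕ × ℕ)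
  output : ℕ → Fin N → Fin (tableSize + 1) → ℕ

/-- The table entry applied to qubit `j` after the outcomes `h`: the first entry whose output
wire carries `true` (entry `0` if there is none). -/
def Program.select {N : ℕ} (P : Program N) (h : List (Fin N → Fin P.outcomes)) (j : Fin N) :
    Fin (P.tableSize + 1) :=
  ((List.finRange (P.tableSize + 1)).find? fun k =>
    (nandEval (P.control h.length) (encodeHistory h)).getD (P.output h.length j k) false).getD 0

/-- The protocol that remains when `r` rounds are left and `h` are the outcomes so far. -/
def Program.unfold {N : ℕ} (P : Program N) : ℕ → List (Fin N → Fin P.outcomes) → Protocol N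
  | 0, _ => .done
  | r + 1, h => .round P.outcomes (fun j => P.table (P.select h j))
      (fun o => P.unfold r (h ++ [o]))

def Program.toProtocol {N : ℕ} (P : Program N) : Protocol N := P.unfold P.rounds []

/-- The number of rounds, the description of the instruments and the classical computation in
each round are all bounded by `b`. -/
def Program.BoundedBy {N : ℕ} (P : Program N) (b : ℕ) : Prop :=
  P.rounds ≤ b ∧ P.outcomes ≤ b ∧ P.tableSize + 1 ≤ b ∧
    ∀ t, t < P.rounds → (P.control t).length ≤ b

/-! ### Efficient universality -/

/-- Efficient universal resource: every family of states with polynomial-size circuits can be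
prepared from states of the resource on polynomially many qubits, by LOCC in polynomial time
with polynomially bounded classical side-processing. -/
def IsEfficientUniversal (Ψ : Resource) : Prop :=
  ∀ φ : ∀ n : ℕ, QState n, PolyPreparable φ →
    ∃ p : Polynomial ℕ, ∀ n, 1 ≤ n →
      ∃ (N : ℕ) (ψ : QState N) (f : Fin n ↪ Fin N) (P : Program N),
        (⟨N, ψ⟩ : Σ N : ℕ, QState N) ∈ Ψ ∧ N ≤ p.eval n ∧ P.BoundedBy (p.eval n) ∧
          P.toProtocol.Transforms ψ.1 (placeVec f (φ n).1)

/-- The same with polynomial spatial overhead only: no bound on the duration of the LOCC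
protocol or on the classical side-processing. -/
def IsSpatiallyEfficientUniversal (Ψ : Resource) : Prop :=
  ∀ φ : ∀ n : ℕ, QState n, PolyPreparable φ →
    ∃ p : Polynomial ℕ, ∀ n, 1 ≤ n →
      ∃ (N : ℕ) (ψ : QState N) (f : Fin n ↪ Fin N),
        (⟨N, ψ⟩ : Σ N : ℕ, QState N) ∈ Ψ ∧ N ≤ p.eval n ∧ ConvertibleOn f ψ.1 (φ n).1

/-! ### Bipartite entanglement -/

/-- The configuration that equals `x` on `A` and `y` on the complement of `A`. -/
def glue {N : ℕ} (A : Finset (Fin N)) (x : {j // j ∈ A} → Fin 2) (y : {j // j ∉ A} → Fin 2) :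
    Fin N → Fin 2 :=
  fun j => if h : j ∈ A then x ⟨j, h⟩ else y ⟨j, h⟩

/-- The coefficient matrix of `ψ` with respect to the bipartition `(A, Aᶜ)`. -/
def coeffMatrix {N : ℕ} (ψ : Vec N) (A : Finset (Fin N)) :
    Matrix ({j // j ∈ A} → Fin 2) ({j // j ∉ A} → Fin 2) ℂ :=
  Matrix.of fun x y => ψ (glue A x y)

/-- The reduced density operator `ρ_A = Tr_{Aᶜ} |ψ⟩⟨ψ|`. -/
def reducedDensity {N : ℕ} (ψ : Vec N) (A : Finset (Fin N)) :
    Matrix ({j // j ∈ A} → Fin 2) ({j // j ∈ A} → Fin 2) ℂ :=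
  coeffMatrix ψ A * (coeffMatrix ψ A)ᴴ

/-- Entanglement entropy `- Tr (ρ_A log₂ ρ_A)`. -/
def entanglementEntropy {N : ℕ} (ψ : Vec N) (A : Finset (Fin N)) : ℝ :=
  (∑ i, Real.negMulLog
    ((Matrix.isHermitian_mul_conjTranspose_self (coeffMatrix ψ A)).eigenvalues i)) / Real.log 2

/-- Schmidt rank: the rank of `ρ_A`. -/
def schmidtRank {N : ℕ} (ψ : Vec N) (A : Finset (Fin N)) : ℕ := (reducedDensity ψ A).rank

/-! ### Entanglement width -/

/-- Subcubic trees whose leaves are identified with the qubits `Fin N`. (There is none for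
`N ≤ 1`.) -/
structure SubcubicTree (N : ℕ) where
  size : ℕ
  graph : SimpleGraph (Fin size)
  isTree : graph.IsTree
  degree_eq : ∀ v, (graph.neighborSet v).ncard = 1 ∨ (graph.neighborSet v).ncard = 3
  leaf : Fin N → Fin size
  leaf_injective : Function.Injective leaf
  mem_range_leaf : ∀ v, v ∈ Set.range leaf ↔ (graph.neighborSet v).ncard = 1

/-- The set of qubits in the component of `d.fst` after deleting the edge of `d`. -/
def SubcubicTree.side {N : ℕ} (T : SubcubicTree N) (d : T.graph.Dart) : Finset (Fin N) :=
  open scoped Classical in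
  Finset.univ.filter fun j => (T.graph.deleteEdges {d.edge}).Reachable d.fst (T.leaf j)

/-- Entropic entanglement width `min_T max_e E_{A_T^e, B_T^e}` (equal to `0` for `N ≤ 1`). Edges
are run through with both orientations, which does not change the maximum. -/
def entropicWidth {N : ℕ} (ψ : QState N) : ℝ :=
  ⨅ T : SubcubicTree N, ⨆ d : T.graph.Dart, entanglementEntropy ψ.1 (T.side d)

/-- Schmidt-rank width `min_T max_e log₂ χ_{A_T^e, B_T^e}` (equal to `0` for `N ≤ 1`). -/
def schmidtRankWidth {N : ℕ} (ψ : QState N) : ℝ :=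
  ⨅ T : SubcubicTree N, ⨆ d : T.graph.Dart, Real.logb 2 (schmidtRank ψ.1 (T.side d))

/-! ### Localizable entanglement, geometric measure, Schmidt measure -/

/-- A Bell pair can be created on the qubits `a`, `b` by deterministic LOCC. -/
def BellCreatable {N : ℕ} (ψ : QState N) (a b : Fin N) : Prop :=
  ∃ f : Fin 2 ↪ Fin N, f 0 = a ∧ f 1 = b ∧ ConvertibleOn f ψ.1 bellVec

/-- The largest size of a set of qubits such that a Bell pair can be created deterministically
between any two of its elements. -/
def numLE {N : ℕ} (ψ : QState N) : ℕ :=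
  sSup {k : ℕ | ∃ A : Finset (Fin N), A.card = k ∧
    ∀ a ∈ A, ∀ b ∈ A, a ≠ b → BellCreatable ψ a b}

/-- The maximal squared overlap with a complete product state. -/
def maxOverlap {N : ℕ} (ψ : QState N) : ℝ :=
  ⨆ α : Fin N → Qubit, ‖(inner ℂ ψ.1 (productVec α) : ℂ)‖ ^ 2

/-- Geometric measure of entanglement. -/
def geometricMeasure {N : ℕ} (ψ : QState N) : ℝ := - Real.logb 2 (maxOverlap ψ)

/-- Minimal number of complete product states that have `ψ` as a linear combination. -/
def productRank {N : ℕ} (ψ : QState N) : ℕ :=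
  sInf {K : ℕ | ∃ (a : Fin K → ℂ) (α : Fin K → Fin N → Qubit),
    ψ.1 = ∑ i, a i • productVec (α i)}

/-- Schmidt measure. -/
def schmidtMeasure {N : ℕ} (ψ : QState N) : ℝ := Real.logb 2 (productRank ψ)

/-! ### Scaling on a resource -/

/-- `E` scales at most logarithmically with the system size on `Ψ`: `E(ψ) = O(log N)` for the
`N`-qubit states `ψ ∈ Ψ`. -/
def ScalesAtMostLog (E : ∀ {N : ℕ}, QState N → ℝ) (Ψ : Resource) : Prop :=
  ∃ (C : ℝ) (N₀ : ℕ), ∀ (N : ℕ) (ψ : QState N),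
    (⟨N, ψ⟩ : Σ N : ℕ, QState N) ∈ Ψ → N₀ ≤ N → E ψ ≤ C * Real.log N

/-- The block of `L` consecutive qubits starting at position `a`. -/
def block (N a L : ℕ) : Finset (Fin N) :=
  Finset.univ.filter fun j => a ≤ j.val ∧ j.val < a + L

/-- With the qubits of each state arranged on a chain, the entanglement entropy between any
subchain of length `L` and the rest is at most logarithmic in `L`. -/
def BlockEntropyLog (Ψ : Resource) : Prop :=
  ∃ C : ℝ, ∀ (N : ℕ) (ψ : QState N), (⟨N, ψ⟩ : Σ N : ℕ, QState N) ∈ Ψ →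
    ∀ a L : ℕ, 2 ≤ L → a + L ≤ N →
      entanglementEntropy ψ.1 (block N a L) ≤ C * Real.log L

end MQC

end

noncomputable section

namespace MQC

/-! ### Local operators and vectors that are product across a bipartition -/

/-! Everything except the localizable-entanglement case rests on one monotone: the largest overlap
of a state with vectors that are product across a fixed cut `(A, Aᶜ)`. It cannot decrease under
deterministic LOCC. Summed over outcomes, the Kraus branches preserve inner products, and each
branch keeps product vectors product, so Cauchy–Schwarz over the branches carries a bound `μ` from
the target back to the source (`Protocol.Transforms.norm_inner_le`).

The target is the uniform superposition over the binary code `z (i, j) = z (i, 0) + z (0, j)` on a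
square grid of side `2 r² + 1`, prepared with linearly many gates. If `A` holds between `r²` and `2
r²` of its qubits, then `A` misses a full row and a full column, so the part outside `A` determines
the codeword. At the same time `A` meets at least `r` rows or `r` columns, so fixing the part inside
`A` leaves at most a fraction `2^-(r-1)` of the code. Hence the squared overlap across the cut is at
most `2^-(r-1)` (`exists_highly_entangled`).

A resource state convertible to this target inherits the bound across all these cuts. The
eigenvalues of its `ρ_A` are then at most `2^-(r-1)`, so entropy, log Schmidt rank, geometric
measure and Schmidt measure are all at least `r - 1`. For the widths, every subcubic tree has an
edge whose cut lies in the window (`SubcubicTree.exists_balanced`); for chains, some initial block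
does. With `N` polynomial in `r`, a bound `C log N` contradicts `r - 1`.

For `numLE` the targets are GHZ states: measuring out all but two qubits leaves a Bell pair on any
chosen pair, so convertibility to an `n`-qubit GHZ state forces the value to be at least `n`. The W
states are covered by the Schmidt measure, since they are sums of `N` product states. -/

theorem inner_eq_sum {N : ℕ} (v w : Vec N) :
    inner ℂ v w = ∑ x, star (v x) * w x := by
  rw [PiLp.inner_apply]
  exact Finset.sum_congr rfl fun x _ => by
    rw [RCLike.inner_apply, mul_comm]; rfl

theorem applyLocal_apply {N : ℕ} (M : Fin N → Matrix (Fin 2) (Fin 2) ℂ) (v : Vec N)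
    (x : Fin N → Fin 2) : applyLocal M v x = ∑ y, (∏ j, M j (x j) (y j)) * v y := rfl

theorem applyLocal_smul {N : ℕ} (M : Fin N → Matrix (Fin 2) (Fin 2) ℂ) (c : ℂ) (v : Vec N) :
    applyLocal M (c • v) = c • applyLocal M v := by
  ext x
  simp only [applyLocal_apply, PiLp.smul_apply, smul_eq_mul, Finset.mul_sum]
  exact Finset.sum_congr rfl fun y _ => by ring

theorem applyLocal_add {N : ℕ} (M : Fin N → Matrix (Fin 2) (Fin 2) ℂ) (v w : Vec N) :
    applyLocal M (v + w) = applyLocal M v + applyLocal M w := by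
  ext x
  simp only [applyLocal_apply, PiLp.add_apply, mul_add, Finset.sum_add_distrib]

theorem Instrument.sum_star_mul {m : ℕ} (I : Instrument m) (a b : Fin 2) :
    ∑ o, ∑ c, star (I.kraus o c a) * I.kraus o c b = if a = b then 1 else 0 := by
  have h := congrFun (congrFun I.complete a) b
  rw [Matrix.sum_apply] at h
  simpa [Matrix.mul_apply, Matrix.conjTranspose_apply, Matrix.one_apply] using h

/-- The branches of a local measurement together preserve inner products. -/
theorem sum_inner_applyLocal {N m : ℕ} (I : Fin N → Instrument m) (v w : Vec N) :
    ∑ o : Fin N → Fin m, inner ℂ (applyLocal (fun j => (I j).kraus (o j)) v)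
      (applyLocal (fun j => (I j).kraus (o j)) w) = inner ℂ v w := by
  have key : ∀ y z : Fin N → Fin 2,
      ∑ o : Fin N → Fin m, ∑ x : Fin N → Fin 2,
        (∏ j, star ((I j).kraus (o j) (x j) (y j))) * ∏ j, (I j).kraus (o j) (x j) (z j)
      = if y = z then 1 else 0 := by
    intro y z
    -- The sum over configurations factorises over qubits; the sum over outcome strings then does
    -- too, and each factor becomes an entry of `∑ K†K = 1`.
    have h1 : ∀ o : Fin N → Fin m, ∑ x : Fin N → Fin 2,
        (∏ j, star ((I j).kraus (o j) (x j) (y j))) * ∏ j, (I j).kraus (o j) (x j) (z j)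
        = ∏ j, ∑ c, star ((I j).kraus (o j) c (y j)) * (I j).kraus (o j) c (z j) := by
      intro o
      rw [Fintype.prod_sum]
      exact Finset.sum_congr rfl fun x _ => (Finset.prod_mul_distrib).symm
    simp_rw [h1]
    rw [← Fintype.prod_sum fun j k =>
      ∑ c, star ((I j).kraus k c (y j)) * (I j).kraus k c (z j)]
    simp_rw [Instrument.sum_star_mul]
    by_cases h : y = z
    · simp [h]
    · obtain ⟨j, hj⟩ := Function.ne_iff.mp h
      rw [if_neg h]
      exact Finset.prod_eq_zero (Finset.mem_univ j) (if_neg hj)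
  calc _ = ∑ o : Fin N → Fin m, ∑ x : Fin N → Fin 2, ∑ y, ∑ z, (star (v y) * w z) *
        ((∏ j, star ((I j).kraus (o j) (x j) (y j))) * ∏ j, (I j).kraus (o j) (x j) (z j)) := by
        refine Finset.sum_congr rfl fun o _ => ?_
        rw [inner_eq_sum]
        refine Finset.sum_congr rfl fun x _ => ?_
        rw [applyLocal_apply, applyLocal_apply, star_sum, Finset.sum_mul_sum]
        refine Finset.sum_congr rfl fun y _ => Finset.sum_congr rfl fun z _ => ?_
        rw [star_mul', star_prod]
        ring
    _ = ∑ y, ∑ z, (star (v y) * w z) * ∑ o : Fin N → Fin m, ∑ x : Fin N → Fin 2,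
        ((∏ j, star ((I j).kraus (o j) (x j) (y j))) * ∏ j, (I j).kraus (o j) (x j) (z j)) := by
        have h2 : ∀ o : Fin N → Fin m, ∑ x : Fin N → Fin 2, ∑ y, ∑ z, (star (v y) * w z) *
            ((∏ j, star ((I j).kraus (o j) (x j) (y j))) *
              ∏ j, (I j).kraus (o j) (x j) (z j)) =
            ∑ y, ∑ z, ∑ x : Fin N → Fin 2, (star (v y) * w z) *
            ((∏ j, star ((I j).kraus (o j) (x j) (y j))) *
              ∏ j, (I j).kraus (o j) (x j) (z j)) := by
          intro o
          rw [Finset.sum_comm]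
          exact Finset.sum_congr rfl fun y _ => Finset.sum_comm
        simp_rw [h2]
        rw [Finset.sum_comm]
        refine Finset.sum_congr rfl fun y _ => ?_
        rw [Finset.sum_comm]
        refine Finset.sum_congr rfl fun z _ => ?_
        rw [Finset.mul_sum]
        exact Finset.sum_congr rfl fun o _ => (Finset.mul_sum _ _ _).symm
    _ = _ := by
        simp_rw [key]
        rw [inner_eq_sum]
        exact Finset.sum_congr rfl fun y _ => by simp

theorem sum_norm_sq_applyLocal {N m : ℕ} (I : Fin N → Instrument m) (v : Vec N) :
    ∑ o : Fin N → Fin m, ‖applyLocal (fun j => (I j).kraus (o j)) v‖ ^ 2 = ‖v‖ ^ 2 := by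
  have h := sum_inner_applyLocal I v v
  simp_rw [inner_self_eq_norm_sq_to_K] at h
  exact_mod_cast h

/-- The sum over configurations, split along a bipartition. -/
theorem sum_eq_sum_glue {N : ℕ} {M : Type*} [AddCommMonoid M] (A : Finset (Fin N))
    (g : (Fin N → Fin 2) → M) : ∑ x, g x = ∑ a, ∑ b, g (glue A a b) := by
  rw [← Fintype.sum_prod_type',
    ← (Equiv.piEquivPiSubtypeProd (· ∈ A) (fun _ : Fin N => Fin 2)).symm.sum_comp]
  rfl

theorem glue_of_mem {N : ℕ} (A : Finset (Fin N)) (a : {j // j ∈ A} → Fin 2)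
    (b : {j // j ∉ A} → Fin 2) (j : {j // j ∈ A}) : glue A a b j = a j := by
  simp [glue]

theorem glue_of_notMem {N : ℕ} (A : Finset (Fin N)) (a : {j // j ∈ A} → Fin 2)
    (b : {j // j ∉ A} → Fin 2) (j : {j // j ∉ A}) : glue A a b j = b j := by
  simp [glue, j.2]

theorem prod_mem_mul_prod_notMem {N : ℕ} {M : Type*} [CommMonoid M] (A : Finset (Fin N))
    (g : Fin N → M) : (∏ j : {j // j ∈ A}, g j) * ∏ j : {j // j ∉ A}, g j = ∏ j, g j := by
  rw [← Fintype.prod_subtype_mul_prod_subtype (· ∈ A) g]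
  congr 1
  exact Finset.prod_congr (by ext; simp) fun _ _ => rfl

/-- `v = a ⊗ b` across the bipartition `(A, Aᶜ)`. -/
def IsBiproduct {N : ℕ} (A : Finset (Fin N)) (v : Vec N)
    (a : ({j // j ∈ A} → Fin 2) → ℂ) (b : ({j // j ∉ A} → Fin 2) → ℂ) : Prop :=
  ∀ x, v x = a (fun j => x j) * b (fun j => x j)

theorem IsBiproduct.apply_glue {N : ℕ} {A : Finset (Fin N)} {v : Vec N}
    {a : ({j // j ∈ A} → Fin 2) → ℂ} {b : ({j // j ∉ A} → Fin 2) → ℂ} (h : IsBiproduct A v a b)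
    (x : {j // j ∈ A} → Fin 2) (y : {j // j ∉ A} → Fin 2) : v (glue A x y) = a x * b y := by
  rw [h]
  simp_rw [glue_of_mem, glue_of_notMem]

theorem IsBiproduct.norm_sq {N : ℕ} {A : Finset (Fin N)} {v : Vec N}
    {a : ({j // j ∈ A} → Fin 2) → ℂ} {b : ({j // j ∉ A} → Fin 2) → ℂ} (h : IsBiproduct A v a b) :
    ‖v‖ ^ 2 = (∑ x, ‖a x‖ ^ 2) * ∑ y, ‖b y‖ ^ 2 := by
  rw [EuclideanSpace.norm_sq_eq, sum_eq_sum_glue A, Finset.sum_mul_sum]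
  simp_rw [h.apply_glue, norm_mul, mul_pow]

/-- The weight of a pair of configurations in a local operator is a product over qubits, so it
splits into a factor on `A` and one on the complement. This keeps the test vector admissible in
every branch. -/
theorem IsBiproduct.applyLocal {N : ℕ} {A : Finset (Fin N)} {v : Vec N}
    {a : ({j // j ∈ A} → Fin 2) → ℂ} {b : ({j // j ∉ A} → Fin 2) → ℂ} (h : IsBiproduct A v a b)
    (M : Fin N → Matrix (Fin 2) (Fin 2) ℂ) :
    IsBiproduct A (applyLocal M v)
      (fun x => ∑ x', (∏ j : {j // j ∈ A}, M j (x j) (x' j)) * a x')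
      (fun y => ∑ y', (∏ j : {j // j ∉ A}, M j (y j) (y' j)) * b y') := by
  intro x
  rw [applyLocal_apply, sum_eq_sum_glue A, Finset.sum_mul_sum]
  refine Finset.sum_congr rfl fun p _ => Finset.sum_congr rfl fun q _ => ?_
  rw [h.apply_glue, ← prod_mem_mul_prod_notMem A]
  simp_rw [glue_of_mem, glue_of_notMem]
  ring

theorem isBiproduct_productVec {N : ℕ} (A : Finset (Fin N)) (α : Fin N → Qubit) :
    IsBiproduct A (productVec α) (fun x => ∏ j : {j // j ∈ A}, (α j).1 (x j))
      (fun y => ∏ j : {j // j ∉ A}, (α j).1 (y j)) := fun x =>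
  (prod_mem_mul_prod_notMem A fun j => (α j).1 (x j)).symm

/-- The overlap of `v` with normalised vectors `a ⊗ b` is at most `μ`. -/
def BiproductOverlapLE {N : ℕ} (A : Finset (Fin N)) (v : Vec N) (μ : ℝ) : Prop :=
  ∀ (π : Vec N) (a : ({j // j ∈ A} → Fin 2) → ℂ) (b : ({j // j ∉ A} → Fin 2) → ℂ),
    IsBiproduct A π a b → ‖(inner ℂ v π : ℂ)‖ ≤ μ * ‖π‖

/-- The maximal overlap with bipartite product vectors does not decrease under deterministic
LOCC. -/
theorem Protocol.Transforms.norm_inner_le {N : ℕ} {A : Finset (Fin N)} {t : Vec N} {μ : ℝ}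
    (hμ : 0 ≤ μ) (ht : ‖t‖ = 1) (hA : BiproductOverlapLE A t μ) {P : Protocol N} {v : Vec N}
    (hP : P.Transforms v t) {π : Vec N} {a : ({j // j ∈ A} → Fin 2) → ℂ}
    {b : ({j // j ∉ A} → Fin 2) → ℂ} (hπ : IsBiproduct A π a b) :
    ‖(inner ℂ v π : ℂ)‖ ≤ μ * ‖v‖ * ‖π‖ := by
  -- Branches are unnormalised and the test vector evolves along with the state, so the bound is
  -- homogeneous in both and both are generalised.
  induction P generalizing v π a b with
  | done =>
    obtain ⟨c, rfl⟩ := hP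
    rw [inner_smul_left, norm_mul, RCLike.norm_conj, norm_smul, ht]
    have := mul_le_mul_of_nonneg_left (hA π a b hπ) (norm_nonneg c)
    linarith
  | round m I next ih =>
    rw [← sum_inner_applyLocal I v π]
    set K : (Fin N → Fin m) → Vec N → Vec N :=
      fun o => MQC.applyLocal (fun j => (I j).kraus (o j)) with hK
    have h1 : ‖∑ o, (inner ℂ (K o v) (K o π) : ℂ)‖ ≤ ∑ o, μ * (‖K o v‖ * ‖K o π‖) := by
      refine (norm_sum_le _ _).trans (Finset.sum_le_sum fun o _ => ?_)
      rw [← mul_assoc]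
      exact ih o (hP o) (hπ.applyLocal _)
    refine h1.trans ?_
    rw [← Finset.mul_sum, mul_assoc]
    -- Cauchy–Schwarz over the outcomes; the branch norms squared add up to the original ones.
    refine mul_le_mul_of_nonneg_left ?_ hμ
    refine le_of_sq_le_sq ?_ (by positivity)
    refine (Finset.sum_mul_sq_le_sq_mul_sq _ _ _).trans (le_of_eq ?_)
    rw [sum_norm_sq_applyLocal I v, sum_norm_sq_applyLocal I π, mul_pow]

theorem BiproductOverlapLE.of_convertible {N n : ℕ} {A : Finset (Fin N)} {f : Fin n ↪ Fin N}
    {φ : Vec n} {μ : ℝ} (hμ : 0 ≤ μ) (hφ : ‖placeVec f φ‖ = 1)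
    (hA : BiproductOverlapLE A (placeVec f φ) μ) {ψ : QState N} (h : ConvertibleOn f ψ.1 φ) :
    BiproductOverlapLE A ψ.1 μ := by
  intro π a b hπ
  obtain ⟨P, hP⟩ := h
  simpa [ψ.2] using hP.norm_inner_le hμ hφ hA hπ

/-! ### Bounds on the measures in terms of the overlap with product vectors -/

/-- The Schmidt coefficients of `ψ`: the eigenvalues of `ρ_A`. -/
def schmidtWeight {N : ℕ} (ψ : Vec N) (A : Finset (Fin N)) (i : {j // j ∈ A} → Fin 2) : ℝ :=
  (Matrix.isHermitian_mul_conjTranspose_self (coeffMatrix ψ A)).eigenvalues i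

open scoped ComplexOrder in
theorem schmidtWeight_nonneg {N : ℕ} (ψ : Vec N) (A : Finset (Fin N))
    (i : {j // j ∈ A} → Fin 2) : 0 ≤ schmidtWeight ψ A i :=
  (Matrix.posSemidef_self_mul_conjTranspose (coeffMatrix ψ A)).eigenvalues_nonneg i

theorem sum_schmidtWeight {N : ℕ} (ψ : QState N) (A : Finset (Fin N)) :
    ∑ i, schmidtWeight ψ.1 A i = 1 := by
  have h := (Matrix.isHermitian_mul_conjTranspose_self
    (coeffMatrix ψ.1 A)).trace_eq_sum_eigenvalues
  have h2 : (coeffMatrix ψ.1 A * (coeffMatrix ψ.1 A)ᴴ).trace = ((‖ψ.1‖ ^ 2 : ℝ) : ℂ) := by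
    rw [EuclideanSpace.norm_sq_eq, sum_eq_sum_glue A, Matrix.trace]
    push_cast
    refine Finset.sum_congr rfl fun x _ => ?_
    rw [Matrix.diag_apply, Matrix.mul_apply]
    refine Finset.sum_congr rfl fun y _ => ?_
    rw [Matrix.conjTranspose_apply]
    exact RCLike.mul_conj _
  rw [h2, ψ.2] at h
  have h3 : (1 : ℂ) = ((∑ i, schmidtWeight ψ.1 A i : ℝ) : ℂ) := by
    push_cast
    simpa [schmidtWeight] using h
  exact_mod_cast h3.symm

/-- For a unit eigenvector `u` of `M Mᴴ` with eigenvalue `p`, test against `π = u ⊗ star (Mᴴ u)`.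
Both `⟨ψ, π⟩` and `‖π‖²` equal `p`, so `p² ≤ μ² p`. -/
theorem BiproductOverlapLE.schmidtWeight_le {N : ℕ} {ψ : Vec N} {A : Finset (Fin N)} {μ : ℝ}
    (h : BiproductOverlapLE A ψ μ) (i : {j // j ∈ A} → Fin 2) :
    schmidtWeight ψ A i ≤ μ ^ 2 := by
  set M := coeffMatrix ψ A with hM
  set hH := Matrix.isHermitian_mul_conjTranspose_self M
  set p := schmidtWeight ψ A i with hp
  have hp0 : 0 ≤ p := schmidtWeight_nonneg ψ A i
  set u : ({j // j ∈ A} → Fin 2) → ℂ := (hH.eigenvectorBasis i).ofLp with hu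
  have hu1 : ∑ x, ‖u x‖ ^ 2 = 1 := by
    rw [← EuclideanSpace.norm_sq_eq, hH.eigenvectorBasis.orthonormal.1 i, one_pow]
  have hev : (M * Mᴴ) *ᵥ u = (p : ℂ) • u := by
    have := hH.mulVec_eigenvectorBasis i
    rw [this]
    ext x
    simp [hp, schmidtWeight, hu, hM]
  set w := Mᴴ *ᵥ u with hw
  have hww : star w ⬝ᵥ w = (p : ℂ) := by
    rw [hw, Matrix.star_mulVec, Matrix.conjTranspose_conjTranspose, ← Matrix.dotProduct_mulVec,
      Matrix.mulVec_mulVec, hev, dotProduct_smul, smul_eq_mul]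
    have : star u ⬝ᵥ u = ((∑ x, ‖u x‖ ^ 2 : ℝ) : ℂ) := by
      push_cast
      exact Finset.sum_congr rfl fun x _ => RCLike.conj_mul _
    rw [this, hu1]
    simp
  have hw2 : ∑ y, ‖w y‖ ^ 2 = p := by
    have : star w ⬝ᵥ w = ((∑ x, ‖w x‖ ^ 2 : ℝ) : ℂ) := by
      push_cast
      exact Finset.sum_congr rfl fun x _ => RCLike.conj_mul _
    rw [this] at hww
    exact_mod_cast hww
  set π : Vec N := WithLp.toLp 2 fun x => u (fun j => x j) * star (w fun j => x j) with hπ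
  have hprod : IsBiproduct A π u (star w) := fun x => rfl
  have hn : ‖π‖ ^ 2 = p := by
    rw [hprod.norm_sq, hu1, one_mul]
    simp_rw [Pi.star_apply, norm_star]
    exact hw2
  have hin : (inner ℂ ψ π : ℂ) = p := by
    rw [inner_eq_sum, sum_eq_sum_glue A, Finset.sum_comm, ← hww]
    simp_rw [hprod.apply_glue]
    rw [dotProduct_comm, dotProduct]
    refine Finset.sum_congr rfl fun y _ => ?_
    rw [hw, Matrix.mulVec, dotProduct, Finset.sum_mul]
    refine Finset.sum_congr rfl fun x _ => ?_
    rw [← mul_assoc]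
    rfl
  have hle := h π u _ hprod
  rw [hin] at hle
  have hpn : ‖(p : ℂ)‖ = p := by simp [abs_of_nonneg hp0]
  rw [hpn] at hle
  have hsq : p ^ 2 ≤ μ ^ 2 * p := by
    calc p ^ 2 ≤ (μ * ‖π‖) ^ 2 := by gcongr
      _ = μ ^ 2 * p := by rw [mul_pow, hn]
  rcases hp0.eq_or_lt with h0 | h0
  · rw [← h0]; positivity
  · nlinarith

/-- Entropy dominates min-entropy: the average of `-log p` over the spectrum is at least its
smallest value. -/
theorem BiproductOverlapLE.le_entanglementEntropy {N : ℕ} {ψ : QState N} {A : Finset (Fin N)}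
    {μ : ℝ} (h : BiproductOverlapLE A ψ.1 μ) :
    -Real.logb 2 (μ ^ 2) ≤ entanglementEntropy ψ.1 A := by
  rw [entanglementEntropy, Real.logb, ← neg_div]
  refine div_le_div_of_nonneg_right ?_ (Real.log_nonneg (by norm_num))
  change _ ≤ ∑ i, Real.negMulLog (schmidtWeight ψ.1 A i)
  calc -Real.log (μ ^ 2) = ∑ i, schmidtWeight ψ.1 A i * (-Real.log (μ ^ 2)) := by
        rw [← Finset.sum_mul, sum_schmidtWeight, one_mul]
    _ ≤ _ := by
        refine Finset.sum_le_sum fun i _ => ?_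
        rw [Real.negMulLog]
        rcases (schmidtWeight_nonneg ψ.1 A i).eq_or_lt with h0 | h0
        · simp [← h0]
        · have := Real.log_le_log h0 (h.schmidtWeight_le i)
          nlinarith

/-- The nonzero eigenvalues sum to one, each is at most `μ²`, and the rank counts them. -/
theorem BiproductOverlapLE.one_le_mul_schmidtRank {N : ℕ} {ψ : QState N} {A : Finset (Fin N)}
    {μ : ℝ} (h : BiproductOverlapLE A ψ.1 μ) : 1 ≤ μ ^ 2 * schmidtRank ψ.1 A := by
  have hr : schmidtRank ψ.1 A = (Finset.univ.filter fun i => schmidtWeight ψ.1 A i ≠ 0).card := by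
    rw [schmidtRank, reducedDensity, (Matrix.isHermitian_mul_conjTranspose_self
      (coeffMatrix ψ.1 A)).rank_eq_card_non_zero_eigs, Fintype.card_subtype]
    rfl
  refine (sum_schmidtWeight ψ A).symm.le.trans ?_
  rw [hr, ← Finset.sum_filter_ne_zero, mul_comm, ← nsmul_eq_mul]
  exact Finset.sum_le_card_nsmul _ _ _ fun i _ => h.schmidtWeight_le i

theorem neg_logb_le_of_one_le_mul {x y : ℝ} (hx : 0 < x) (h : 1 ≤ x * y) :
    -Real.logb 2 x ≤ Real.logb 2 y := by
  rw [← Real.logb_inv]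
  refine Real.logb_le_logb_of_le (by norm_num) (inv_pos.mpr hx) ?_
  rwa [inv_le_iff_one_le_mul₀' hx]

theorem BiproductOverlapLE.le_logb_schmidtRank {N : ℕ} {ψ : QState N} {A : Finset (Fin N)}
    {μ : ℝ} (hμ : 0 < μ) (h : BiproductOverlapLE A ψ.1 μ) :
    -Real.logb 2 (μ ^ 2) ≤ Real.logb 2 (schmidtRank ψ.1 A) :=
  neg_logb_le_of_one_le_mul (by positivity) h.one_le_mul_schmidtRank

/-! ### Schmidt measure, geometric measure and widths -/

/-- The computational basis states are product states. -/
theorem exists_productVec_eq_single {N : ℕ} (x : Fin N → Fin 2) :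
    ∃ α : Fin N → Qubit, productVec α = EuclideanSpace.single x 1 := by
  refine ⟨fun j => ⟨EuclideanSpace.single (x j) 1, by simp⟩, ?_⟩
  ext y
  simp only [productVec, PiLp.single_apply, Finset.prod_ite_zero, Finset.prod_const_one]
  simp [funext_iff]

theorem eq_sum_smul_single {N : ℕ} (v : Vec N) :
    v = ∑ x, v x • (EuclideanSpace.single x 1 : Vec N) := by
  ext y
  simp [Finset.sum_apply, Pi.single_apply]

/-- Expansion in the computational basis shows that the set under `sInf` is nonempty, so the infimum
is attained and is not the default value `0`. -/
theorem productRank_spec {N : ℕ} (ψ : QState N) :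
    ∃ (a : Fin (productRank ψ) → ℂ) (α : Fin (productRank ψ) → Fin N → Qubit),
      ψ.1 = ∑ i, a i • productVec (α i) := by
  refine Nat.sInf_mem (s := {K : ℕ | ∃ (a : Fin K → ℂ) (α : Fin K → Fin N → Qubit),
    ψ.1 = ∑ i, a i • productVec (α i)}) ?_
  choose α hα using fun x : Fin N → Fin 2 => exists_productVec_eq_single x
  let e := Fintype.equivFin (Fin N → Fin 2)
  refine ⟨_, fun i => ψ.1 (e.symm i), fun i => α (e.symm i), ?_⟩
  rw [e.symm.sum_comp fun x => ψ.1 x • productVec (α x)]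
  simp_rw [hα]
  exact eq_sum_smul_single _

/-- A decomposition into `K` product states factors the coefficient matrix through a `K`-dimensional
space. -/
theorem schmidtRank_le_productRank {N : ℕ} (ψ : QState N) (A : Finset (Fin N)) :
    schmidtRank ψ.1 A ≤ productRank ψ := by
  obtain ⟨a, α, h⟩ := productRank_spec ψ
  have hfac : coeffMatrix ψ.1 A =
      (Matrix.of fun (x : {j // j ∈ A} → Fin 2) i =>
        a i * ∏ j : {j // j ∈ A}, (α i j).1 (x j)) *
      Matrix.of fun i (y : {j // j ∉ A} → Fin 2) => ∏ j : {j // j ∉ A}, (α i j).1 (y j) := by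
    ext x y
    rw [coeffMatrix, Matrix.of_apply, h, Matrix.mul_apply, WithLp.ofLp_sum, Finset.sum_apply]
    refine Finset.sum_congr rfl fun i _ => ?_
    rw [PiLp.smul_apply, (isBiproduct_productVec A (α i)).apply_glue, smul_eq_mul, ← mul_assoc]
    simp only [Matrix.of_apply]
  refine (Matrix.rank_mul_le_left _ _).trans ?_
  rw [hfac]
  refine (Matrix.rank_mul_le_left _ _).trans ((Matrix.rank_le_card_width _).trans ?_)
  rw [Fintype.card_fin]

theorem BiproductOverlapLE.le_schmidtMeasure {N : ℕ} {ψ : QState N} {A : Finset (Fin N)}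
    {μ : ℝ} (hμ : 0 < μ) (h : BiproductOverlapLE A ψ.1 μ) :
    -Real.logb 2 (μ ^ 2) ≤ schmidtMeasure ψ := by
  refine neg_logb_le_of_one_le_mul (by positivity) (h.one_le_mul_schmidtRank.trans ?_)
  gcongr
  exact schmidtRank_le_productRank ψ A

theorem norm_productVec {N : ℕ} (α : Fin N → Qubit) : ‖productVec α‖ = 1 := by
  have h : ‖productVec α‖ ^ 2 = 1 := by
    rw [EuclideanSpace.norm_sq_eq]
    simp only [productVec, norm_prod, ← Finset.prod_pow]
    rw [← Fintype.prod_sum fun j c => ‖(α j).1 c‖ ^ 2]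
    refine Finset.prod_eq_one fun j _ => ?_
    rw [← EuclideanSpace.norm_sq_eq, (α j).2, one_pow]
  exact (pow_eq_one_iff_of_nonneg (norm_nonneg _) two_ne_zero).mp h

theorem norm_inner_productVec_sq_le {N : ℕ} (ψ : QState N) (α : Fin N → Qubit) :
    ‖(inner ℂ ψ.1 (productVec α) : ℂ)‖ ^ 2 ≤ 1 := by
  have := norm_inner_le_norm (𝕜 := ℂ) ψ.1 (productVec α)
  rw [ψ.2, norm_productVec, one_mul] at this
  exact pow_le_one₀ (norm_nonneg _) this

theorem maxOverlap_pos {N : ℕ} (ψ : QState N) : 0 < maxOverlap ψ := by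
  obtain ⟨x, hx⟩ : ∃ x, ψ.1 x ≠ 0 := by
    by_contra! h
    have h0 : ψ.1 = 0 := by ext x; exact h x
    have := ψ.2
    rw [h0, norm_zero] at this
    exact zero_ne_one this
  obtain ⟨α, hα⟩ := exists_productVec_eq_single x
  refine lt_of_lt_of_le ?_ (le_ciSup (f := fun α : Fin N → Qubit =>
    ‖(inner ℂ ψ.1 (productVec α) : ℂ)‖ ^ 2)
    ⟨1, by rintro _ ⟨β, rfl⟩; exact norm_inner_productVec_sq_le ψ β⟩ α)
  simp only [hα, EuclideanSpace.inner_single_right]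
  simp [hx]

theorem BiproductOverlapLE.le_geometricMeasure {N : ℕ} {ψ : QState N} {A : Finset (Fin N)}
    {μ : ℝ} (h : BiproductOverlapLE A ψ.1 μ) :
    -Real.logb 2 (μ ^ 2) ≤ geometricMeasure ψ := by
  rw [geometricMeasure]
  refine neg_le_neg (Real.logb_le_logb_of_le (by norm_num) (maxOverlap_pos ψ) ?_)
  obtain ⟨α₀, -⟩ := exists_productVec_eq_single (0 : Fin N → Fin 2)
  have : Nonempty (Fin N → Qubit) := ⟨α₀⟩
  refine ciSup_le fun α => ?_
  have := h _ _ _ (isBiproduct_productVec A α)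
  rw [norm_productVec, mul_one] at this
  gcongr

/-- A real infimum over an empty type is `0`, so the existence of a tree has to be supplied. -/
theorem le_entropicWidth {N : ℕ} {ψ : QState N} {c : ℝ} (hN : Nonempty (SubcubicTree N))
    (h : ∀ T : SubcubicTree N, ∃ d : T.graph.Dart, c ≤ entanglementEntropy ψ.1 (T.side d)) :
    c ≤ entropicWidth ψ := by
  refine le_ciInf fun T => ?_
  obtain ⟨d, hd⟩ := h T
  have : Finite T.graph.Dart := by classical infer_instance
  exact hd.trans (le_ciSup (f := fun d => entanglementEntropy ψ.1 (T.side d))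
    (Set.finite_range _).bddAbove d)

theorem le_schmidtRankWidth {N : ℕ} {ψ : QState N} {c : ℝ} (hN : Nonempty (SubcubicTree N))
    (h : ∀ T : SubcubicTree N, ∃ d : T.graph.Dart,
      c ≤ Real.logb 2 (schmidtRank ψ.1 (T.side d))) :
    c ≤ schmidtRankWidth ψ := by
  refine le_ciInf fun T => ?_
  obtain ⟨d, hd⟩ := h T
  have : Finite T.graph.Dart := by classical infer_instance
  exact hd.trans (le_ciSup (f := fun d => Real.logb 2 (schmidtRank ψ.1 (T.side d)))
    (Set.finite_range _).bddAbove d)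

/-- The W state is a superposition of `N` product states. -/
theorem schmidtMeasure_wState_le {N : ℕ} (hN : 1 ≤ N) :
    schmidtMeasure (wState N hN) ≤ Real.logb 2 N := by
  have hle : productRank (wState N hN) ≤ N := by
    choose α hα using fun i : Fin N => exists_productVec_eq_single (oneHot i)
    refine Nat.sInf_le ⟨fun _ => (Real.sqrt N : ℂ)⁻¹, α, ?_⟩
    simp_rw [hα]
    rw [← Finset.smul_sum]
    rfl
  have hN' : (1 : ℝ) ≤ N := by exact_mod_cast hN
  rw [schmidtMeasure]
  -- The convention `logb 2 0 = 0` disposes of rank zero without a proof that the rank is positive.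
  rcases Nat.eq_zero_or_pos (productRank (wState N hN)) with h0 | h0
  · rw [h0]
    simpa using Real.logb_nonneg (by norm_num) hN'
  · exact Real.logb_le_logb_of_le (by norm_num) (by exact_mod_cast h0) (by exact_mod_cast hle)

theorem scalesAtMostLog_schmidtMeasure_wResource :
    ScalesAtMostLog schmidtMeasure wResource := by
  refine ⟨(Real.log 2)⁻¹, 0, ?_⟩
  rintro N ψ ⟨M, hM, h⟩ -
  obtain ⟨rfl, h⟩ := Sigma.mk.inj_iff.mp h
  rw [eq_of_heq h]
  refine (schmidtMeasure_wState_le hM).trans (le_of_eq ?_)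
  rw [Real.logb, div_eq_inv_mul]

/-! ### Circuits -/

/-- The tensor product of (not necessarily normalised) single-qubit vectors. -/
def tensorVec {N : ℕ} (α : Fin N → Fin 2 → ℂ) : Vec N :=
  WithLp.toLp 2 fun x => ∏ j, α j (x j)

theorem applyLocal_tensorVec {N : ℕ} (M : Fin N → Matrix (Fin 2) (Fin 2) ℂ)
    (α : Fin N → Fin 2 → ℂ) :
    applyLocal M (tensorVec α) = tensorVec fun j => M j *ᵥ α j := by
  ext x
  simp only [applyLocal_apply, tensorVec, Matrix.mulVec, dotProduct]
  rw [Fintype.prod_sum]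
  exact Finset.sum_congr rfl fun y _ => Finset.prod_mul_distrib.symm

theorem single_eq_tensorVec {N : ℕ} (x : Fin N → Fin 2) :
    (EuclideanSpace.single x 1 : Vec N) = tensorVec fun j => Pi.single (x j) 1 := by
  ext y
  simp only [PiLp.single_apply, tensorVec, Pi.single_apply, Finset.prod_ite_zero,
    Finset.prod_const_one]
  simp [funext_iff]

theorem Gate.norm_apply {n : ℕ} (g : Gate n) (v : Vec n) : ‖g.apply v‖ = ‖v‖ := by
  refine (sq_eq_sq₀ (norm_nonneg _) (norm_nonneg _)).mp ?_
  cases g with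
  | single j U =>
    -- A unitary gate is an instrument with a single outcome, so norm preservation is already known.
    have hI : ∀ i : Fin n, ∑ _o : Fin 1,
        (Function.update (fun _ => (1 : Matrix (Fin 2) (Fin 2) ℂ)) j U.1 i)ᴴ *
        Function.update (fun _ => (1 : Matrix (Fin 2) (Fin 2) ℂ)) j U.1 i = 1 := by
      intro i
      rcases eq_or_ne i j with rfl | h
      · simpa [Matrix.star_eq_conjTranspose] using
          Matrix.mem_unitaryGroup_iff'.mp (Matrix.mem_specialUnitaryGroup_iff.mp U.2).1
      · simp [h]
    have h := sum_norm_sq_applyLocal (fun i => (⟨fun _ => _, hI i⟩ : Instrument 1)) v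
    rwa [Fintype.sum_unique] at h
  | cnot c t hct =>
    rw [EuclideanSpace.norm_sq_eq, EuclideanSpace.norm_sq_eq]
    have hinv : Function.Involutive
        fun x : Fin n → Fin 2 => Function.update x t (x t + x c) := by
      intro x
      ext1 j
      rcases eq_or_ne j t with rfl | h
      · have key : ∀ a b : Fin 2, a + b + b = a := by decide
        simp [hct, key]
      · simp [h]
    exact Equiv.sum_comp hinv.toPerm fun x => ‖v x‖ ^ 2

theorem norm_circuitOutput {n : ℕ} (gates : List (Gate n)) : ‖circuitOutput gates‖ = 1 := by
  have h : ∀ v : Vec n, ‖gates.foldl (fun v g => g.apply v) v‖ = ‖v‖ := by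
    induction gates with
    | nil => exact fun _ => rfl
    | cons g l ih => exact fun v => (ih _).trans (g.norm_apply v)
  rw [circuitOutput, h, zeroVec]
  simp

theorem inv_sqrt_two_sq : (Real.sqrt 2 : ℂ)⁻¹ * (Real.sqrt 2 : ℂ)⁻¹ = 2⁻¹ := by
  rw [← mul_inv, ← Complex.ofReal_mul, Real.mul_self_sqrt (by norm_num)]
  norm_num

/-- The rotation with `|0⟩ ↦ (|0⟩ + |1⟩)/√2`. -/
def rotation : Matrix.specialUnitaryGroup (Fin 2) ℂ :=
  ⟨(Real.sqrt 2 : ℂ)⁻¹ • !![1, -1; 1, 1], by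
    rw [Matrix.mem_specialUnitaryGroup_iff, Matrix.mem_unitaryGroup_iff]
    constructor
    · ext i j
      fin_cases i <;> fin_cases j <;>
        simp [Matrix.mul_apply, Fin.sum_univ_two, Matrix.star_apply, inv_sqrt_two_sq] <;> norm_num
    · rw [Matrix.det_smul, Matrix.det_fin_two_of, Fintype.card_fin, pow_two, inv_sqrt_two_sq]
      norm_num⟩

theorem rotation_mulVec_single_zero :
    rotation.1 *ᵥ Pi.single 0 1 = fun _ => (Real.sqrt 2 : ℂ)⁻¹ := by
  ext i
  fin_cases i <;> simp [rotation]

theorem foldl_single_tensorVec {n : ℕ} (U : Matrix.specialUnitaryGroup (Fin 2) ℂ)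
    (l : List (Fin n)) (hl : l.Nodup) (α : Fin n → Fin 2 → ℂ) :
    (l.map (Gate.single · U)).foldl (fun v g => g.apply v) (tensorVec α) =
      tensorVec fun j => if j ∈ l then U.1 *ᵥ α j else α j := by
  induction l generalizing α with
  | nil => simp
  | cons i l ih =>
    rw [List.nodup_cons] at hl
    have h1 : (Gate.single i U).apply (tensorVec α) =
        tensorVec fun j =>
          Function.update (fun _ => (1 : Matrix (Fin 2) (Fin 2) ℂ)) i U.1 j *ᵥ α j := by
      rw [← applyLocal_tensorVec, Gate.apply]
    rw [List.map_cons, List.foldl_cons, h1, ih hl.2]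
    congr 1
    ext1 j
    rcases eq_or_ne j i with rfl | h
    · simp [hl.1]
    · simp [h]

/-- The parity added to qubit `j` by CNOT gates with (control, target) in `l`. -/
def parity {n : ℕ} (l : List (Fin n × Fin n)) (x : Fin n → Fin 2) (j : Fin n) : Fin 2 :=
  (l.map fun p => if p.2 = j then x p.1 else 0).sum

/-- CNOT gates with the given controls and targets. -/
def cnots {n : ℕ} (l : List (Fin n × Fin n)) : List (Gate n) :=
  l.flatMap fun p => if h : p.1 ≠ p.2 then [Gate.cnot p.1 p.2 h] else []

theorem length_cnots_le {n : ℕ} (l : List (Fin n × Fin n)) : (cnots l).length ≤ l.length := by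
  induction l with
  | nil => simp [cnots]
  | cons p l ih =>
    rw [cnots, List.flatMap_cons, List.length_append, List.length_cons, add_comm]
    refine Nat.add_le_add ih ?_
    split <;> simp

/-- Controls lie in `F` and targets outside it, so no gate alters a later control: every gate reads
the original bits and the contributions simply add up. -/
theorem foldl_cnots {n : ℕ} (F : Finset (Fin n)) (l : List (Fin n × Fin n))
    (hl : ∀ p ∈ l, p.1 ∈ F ∧ p.2 ∉ F) (v : Vec n) (x : Fin n → Fin 2) :
    (cnots l).foldl (fun v g => g.apply v) v x = v fun j => x j + parity l x j := by
  induction l generalizing v with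
  | nil => simp [cnots, parity]
  | cons p l ih =>
    obtain ⟨h1, h2⟩ := hl p List.mem_cons_self
    have hl' : ∀ q ∈ l, q.1 ∈ F ∧ q.2 ∉ F := fun q hq => hl q (List.mem_cons_of_mem _ hq)
    have hne : p.1 ≠ p.2 := fun h => h2 (h ▸ h1)
    have hp : parity l x p.1 = 0 := by
      refine List.sum_eq_zero fun y hy => ?_
      obtain ⟨q, hq, rfl⟩ := List.mem_map.mp hy
      refine if_neg fun h => (hl' q hq).2 ?_
      rwa [h]
    have hc : cnots (p :: l) = Gate.cnot p.1 p.2 hne :: cnots l := by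
      simp [cnots, hne]
    rw [hc, List.foldl_cons, ih hl']
    change v.ofLp _ = v.ofLp _
    refine congrArg v.ofLp (funext fun j => ?_)
    have hcons : parity (p :: l) x j = (if p.2 = j then x p.1 else 0) + parity l x j := by
      simp [parity]
    rw [hcons]
    rcases eq_or_ne j p.2 with rfl | h
    · rw [Function.update_self]
      beta_reduce
      rw [hp, if_pos rfl, add_zero, add_assoc, add_comm (x p.1)]
    · rw [Function.update_of_ne h, if_neg h.symm, zero_add]

/-- Uniform superpositions over the solutions of a system of parity checks, in which each qubit
is either free or a sum of free ones, have small circuits. -/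
theorem exists_circuit_parityChecks {n : ℕ} (F : Finset (Fin n)) (par : Fin n → List (Fin n))
    (hpar : ∀ j, ∀ c ∈ par j, c ∈ F ∧ j ∉ F) :
    ∃ (gates : List (Gate n)) (c : ℂ), gates.length ≤ n + ∑ j, (par j).length ∧
      ∀ x, circuitOutput gates x =
        if ∀ j, j ∉ F → x j + ((par j).map x).sum = 0 then c else 0 := by
  set l : List (Fin n × Fin n) :=
    (List.finRange n).flatMap fun j => (par j).map fun c => (c, j) with hl
  have hlF : ∀ p ∈ l, p.1 ∈ F ∧ p.2 ∉ F := by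
    intro p hp
    obtain ⟨j, -, hj⟩ := List.mem_flatMap.mp hp
    obtain ⟨c, hc, rfl⟩ := List.mem_map.mp hj
    exact hpar j c hc
  have hsum : ∀ g : Fin n → ℕ, ((List.finRange n).map g).sum = ∑ j, g j := fun g => by
    rw [← List.ofFn_eq_map, List.sum_ofFn]
  have hpl : ∀ x j, parity l x j = ((par j).map x).sum := by
    intro x j
    have h1 : parity l x j = ∑ i, if i = j then ((par i).map x).sum else 0 := by
      rw [parity, hl, List.map_flatMap, List.flatMap_def, List.sum_flatten, List.map_map, ← List.sum_ofFn, List.ofFn_eq_map]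
      congr 1
      refine List.map_congr_left fun i _ => ?_
      rw [Function.comp_apply, List.map_map]
      by_cases h : i = j
      · rw [if_pos h]
        congr 1
        exact List.map_congr_left fun c _ => by simp [h]
      · rw [if_neg h]
        refine List.sum_eq_zero fun y hy => ?_
        obtain ⟨c, -, rfl⟩ := List.mem_map.mp hy
        simp [h]
    rw [h1, Finset.sum_ite_eq' Finset.univ j, if_pos (Finset.mem_univ j)]
  -- Rotations put the free qubits in uniform superposition; the CNOTs then write the required sums
  -- into the others. The amplitude is `2^(-|F|/2)`.
  refine ⟨F.toList.map (Gate.single · rotation) ++ cnots l,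
    ∏ j, if j ∈ F then (Real.sqrt 2 : ℂ)⁻¹ else 1, ?_, ?_⟩
  · rw [List.length_append, List.length_map, Finset.length_toList]
    refine Nat.add_le_add (by simpa using F.card_le_univ) ((length_cnots_le l).trans ?_)
    rw [hl, List.length_flatMap, ← hsum]
    simp
  · intro x
    rw [circuitOutput, List.foldl_append, foldl_cnots F l hlF, zeroVec, single_eq_tensorVec,
      foldl_single_tensorVec _ _ F.nodup_toList]
    simp only [tensorVec, hpl, rotation_mulVec_single_zero, Finset.mem_toList]
    split_ifs with h
    · refine Finset.prod_congr rfl fun j _ => ?_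
      split_ifs with hj
      · rfl
      · rw [h j hj]; simp
    · push Not at h
      obtain ⟨j, hj, hne⟩ := h
      refine Finset.prod_eq_zero (Finset.mem_univ j) ?_
      rw [if_neg hj]
      simp [hne]

/-! ### Placing a state on a subset of the qubits -/

/-- The configurations that vanish off the range of `f` are exactly the extensions by zero of
configurations on the small system. -/
theorem sum_supported {n N : ℕ} {M : Type*} [AddCommMonoid M] (f : Fin n ↪ Fin N)
    (g : (Fin N → Fin 2) → M) [DecidablePred fun x : Fin N → Fin 2 =>
      ∀ j, j ∉ Set.range f → x j = 0] :
    (∑ x, if ∀ j, j ∉ Set.range f → x j = 0 then g x else 0) =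
      ∑ z, g (Function.extend f z 0) := by
  rw [← Finset.sum_filter]
  symm
  refine Finset.sum_bij (fun z _ => Function.extend f z 0) ?_ ?_ ?_ fun _ _ => rfl
  · intro z _
    simp only [Finset.mem_filter, Finset.mem_univ, true_and]
    intro j hj
    exact Function.extend_apply' _ _ _ fun ⟨k, hk⟩ => hj ⟨k, hk⟩
  · intro z _ z' _ h
    exact Function.extend_injective f.injective 0 h
  · intro x hx
    simp only [Finset.mem_filter, Finset.mem_univ, true_and] at hx
    refine ⟨fun k => x (f k), Finset.mem_univ _, ?_⟩
    ext1 j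
    by_cases hj : j ∈ Set.range f
    · obtain ⟨k, rfl⟩ := hj
      exact f.injective.extend_apply _ _ k
    · rw [hx j hj]
      exact Function.extend_apply' _ _ _ fun ⟨k, hk⟩ => hj ⟨k, hk⟩

theorem inner_placeVec {n N : ℕ} (f : Fin n ↪ Fin N) (φ : Vec n) (π : Vec N) :
    inner ℂ (placeVec f φ) π = ∑ z, star (φ z) * π (Function.extend f z 0) := by
  classical
  rw [inner_eq_sum]
  have h := sum_supported f fun x => star (φ fun k => x (f k)) * π x
  simp only [f.injective.extend_apply] at h
  rw [← h]
  refine Finset.sum_congr rfl fun x _ => ?_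
  simp only [placeVec]
  split_ifs <;> simp

theorem norm_placeVec {n N : ℕ} (f : Fin n ↪ Fin N) (φ : Vec n) : ‖placeVec f φ‖ = ‖φ‖ := by
  classical
  refine (sq_eq_sq₀ (norm_nonneg _) (norm_nonneg _)).mp ?_
  rw [EuclideanSpace.norm_sq_eq, EuclideanSpace.norm_sq_eq]
  have h := sum_supported f fun x => ‖φ fun k => x (f k)‖ ^ 2
  simp only [f.injective.extend_apply] at h
  rw [← h]
  refine Finset.sum_congr rfl fun x _ => ?_
  simp only [placeVec]
  split_ifs <;> simp

theorem sum_comp_le_card_mul_sum {ι κ : Type*} [Fintype κ] [DecidableEq κ] (S : Finset ι)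
    (h : ι → κ) (m : ℕ) (hm : ∀ w, (S.filter fun z => h z = w).card ≤ m) (g : κ → ℝ)
    (hg : ∀ w, 0 ≤ g w) : ∑ z ∈ S, g (h z) ≤ m * ∑ w, g w := by
  rw [← Finset.sum_fiberwise S h, Finset.mul_sum]
  refine Finset.sum_le_sum fun w _ => ?_
  rw [Finset.sum_congr rfl fun z hz => congrArg g (Finset.mem_filter.mp hz).2,
    Finset.sum_const, nsmul_eq_mul]
  exact mul_le_mul_of_nonneg_right (by exact_mod_cast hm w) (hg w)

/-- A uniform superposition over `S` has small overlap with product vectors if the restrictions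
of `S` to both parties have small fibres. -/
theorem biproductOverlapLE_placeVec {n N : ℕ} (S : Finset (Fin n → Fin 2)) (c : ℂ) (φ : Vec n)
    (hφ : ∀ z, φ z = if z ∈ S then c else 0) (hn : ‖φ‖ = 1) (f : Fin n ↪ Fin N)
    (A : Finset (Fin N)) (m s : ℕ)
    (hA : ∀ w ∈ S, (S.filter fun z => ∀ k, f k ∈ A → z k = w k).card ≤ m)
    (hB : ∀ w ∈ S, ∀ z ∈ S, (∀ k, f k ∉ A → z k = w k) → z = w)
    (hm : m * 2 ^ s ≤ S.card) :
    BiproductOverlapLE A (placeVec f φ) (Real.sqrt ((1 / 2) ^ s)) := by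
  classical
  intro π a b hπ
  have hc : ‖c‖ ^ 2 * S.card = 1 := by
    have h : ‖φ‖ ^ 2 = 1 := by rw [hn, one_pow]
    rw [EuclideanSpace.norm_sq_eq] at h
    -- Normalisation of a uniform superposition: `‖φ‖²` is `‖c‖²` times the size of `S`.
    rw [← h, mul_comm, ← nsmul_eq_mul, ← Finset.sum_const, ← Finset.univ_inter S,
      ← Finset.sum_ite_mem]
    exact Finset.sum_congr rfl fun z _ => by rw [hφ]; split_ifs <;> simp
  set hα : (Fin n → Fin 2) → {j // j ∈ A} → Fin 2 :=
    fun z j => Function.extend f z 0 j with hα_def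
  set hβ : (Fin n → Fin 2) → {j // j ∉ A} → Fin 2 :=
    fun z j => Function.extend f z 0 j with hβ_def
  have hext : ∀ z k, Function.extend f z (0 : Fin N → Fin 2) (f k) = z k :=
    fun z k => f.injective.extend_apply _ _ k
  have hin : inner ℂ (placeVec f φ) π = ∑ z ∈ S, star c * (a (hα z) * b (hβ z)) := by
    rw [inner_placeVec, ← Finset.univ_inter S, ← Finset.sum_ite_mem]
    refine Finset.sum_congr rfl fun z _ => ?_
    rw [hφ, hπ]
    split_ifs
    · rfl
    · simp
  have h1 : ‖(inner ℂ (placeVec f φ) π : ℂ)‖ ≤ ‖c‖ * ∑ z ∈ S, ‖a (hα z)‖ * ‖b (hβ z)‖ := by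
    rw [hin, Finset.mul_sum]
    refine (norm_sum_le _ _).trans (le_of_eq (Finset.sum_congr rfl fun z _ => ?_))
    rw [norm_mul, norm_star, norm_mul]
  have h2 : ∑ z ∈ S, ‖a (hα z)‖ ^ 2 ≤ m * ∑ x, ‖a x‖ ^ 2 := by
    refine sum_comp_le_card_mul_sum S hα m (fun w => ?_) (fun x => ‖a x‖ ^ 2)
      fun _ => by positivity
    rcases (S.filter fun z => hα z = w).eq_empty_or_nonempty with h0 | ⟨z₀, h0⟩
    · simp [h0]
    · rw [Finset.mem_filter] at h0
      refine (Finset.card_le_card fun z hz => ?_).trans (hA z₀ h0.1)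
      rw [Finset.mem_filter] at hz ⊢
      refine ⟨hz.1, fun k hk => ?_⟩
      rw [← hext z k, ← hext z₀ k]
      exact congrFun (hz.2.trans h0.2.symm) ⟨f k, hk⟩
  have h3 : ∑ z ∈ S, ‖b (hβ z)‖ ^ 2 ≤ (1 : ℕ) * ∑ x, ‖b x‖ ^ 2 := by
    refine sum_comp_le_card_mul_sum S hβ 1 (fun w => ?_) (fun x => ‖b x‖ ^ 2)
      fun _ => by positivity
    refine Finset.card_le_one.mpr fun z hz z' hz' => ?_
    rw [Finset.mem_filter] at hz hz'
    refine hB z' hz'.1 z hz.1 fun k hk => ?_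
    rw [← hext z k, ← hext z' k]
    exact congrFun (hz.2.trans hz'.2.symm) ⟨f k, hk⟩
  rw [Nat.cast_one, one_mul] at h3
  have hm' : (m : ℝ) ≤ S.card * (1 / 2) ^ s := by
    rw [one_div, inv_pow, ← div_eq_mul_inv, le_div_iff₀ (by positivity)]
    exact_mod_cast hm
  refine h1.trans (le_of_sq_le_sq ?_ (by positivity))
  -- After Cauchy–Schwarz over `S`, each value of `a` is hit at most `m` times and each value of `b`
  -- at most once; with `‖c‖² |S| = 1` this leaves the factor `m / |S| ≤ 2^-s`.
  calc (‖c‖ * ∑ z ∈ S, ‖a (hα z)‖ * ‖b (hβ z)‖) ^ 2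
      = ‖c‖ ^ 2 * (∑ z ∈ S, ‖a (hα z)‖ * ‖b (hβ z)‖) ^ 2 := mul_pow _ _ _
    _ ≤ ‖c‖ ^ 2 * ((∑ z ∈ S, ‖a (hα z)‖ ^ 2) * ∑ z ∈ S, ‖b (hβ z)‖ ^ 2) := by
        gcongr
        exact Finset.sum_mul_sq_le_sq_mul_sq _ _ _
    _ ≤ ‖c‖ ^ 2 * ((S.card * (1 / 2) ^ s * ∑ x, ‖a x‖ ^ 2) * ∑ x, ‖b x‖ ^ 2) := by
        gcongr
        exact h2.trans (by gcongr)
    _ = (‖c‖ ^ 2 * S.card) * (1 / 2) ^ s * ‖π‖ ^ 2 := by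
        rw [hπ.norm_sq]; ring
    _ = _ := by
        rw [hc, one_mul, mul_pow, Real.sq_sqrt (by positivity)]

/-! ### A state with large entanglement across all cuts of suitable size -/

/-- The solutions of `z (i, j) = z (i, 0) + z (0, j)` on a `k × k` grid. -/
def gridCode (k : ℕ) [NeZero k] : Finset (Fin (k * k) → Fin 2) :=
  Finset.univ.filter fun z => ∀ i j : Fin k, z (finProdFinEquiv (i, j)) =
    z (finProdFinEquiv (i, 0)) + z (finProdFinEquiv (0, j))

theorem mem_gridCode {k : ℕ} [NeZero k] {z : Fin (k * k) → Fin 2} :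
    z ∈ gridCode k ↔ ∀ i j : Fin k, z (finProdFinEquiv (i, j)) =
      z (finProdFinEquiv (i, 0)) + z (finProdFinEquiv (0, j)) := by
  simp [gridCode]

theorem exists_circuit_gridCode (k : ℕ) [NeZero k] :
    ∃ (gates : List (Gate (k * k))) (c : ℂ), gates.length ≤ 3 * (k * k) ∧
      ∀ z, circuitOutput gates z = if z ∈ gridCode k then c else 0 := by
  classical
  let e : Fin k × Fin k ≃ Fin (k * k) := finProdFinEquiv
  -- Free are the first row and column without their corner. At the corner the code equation reads
  -- `a = a + a`, forcing `a = 0`, which is the check with an empty list.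
  let free : Fin k × Fin k → Prop := fun q => (q.1 = 0 ∧ q.2 ≠ 0) ∨ (q.1 ≠ 0 ∧ q.2 = 0)
  let F : Finset (Fin (k * k)) := Finset.univ.filter fun m => free (e.symm m)
  let par : Fin (k * k) → List (Fin (k * k)) := fun m =>
    if (e.symm m).1 ≠ 0 ∧ (e.symm m).2 ≠ 0 then [e ((e.symm m).1, 0), e (0, (e.symm m).2)] else []
  obtain ⟨gates, c, hlen, hout⟩ := exists_circuit_parityChecks F par (by
    intro m c hc
    simp only [par] at hc
    split_ifs at hc with h
    · simp only [List.mem_cons, List.not_mem_nil, or_false] at hc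
      rcases hc with rfl | rfl <;> simp [F, free, h.1, h.2]
    · simp at hc)
  refine ⟨gates, c, hlen.trans ?_, fun z => ?_⟩
  · have : ∑ m, (par m).length ≤ ∑ _m : Fin (k * k), 2 :=
      Finset.sum_le_sum fun m _ => by simp only [par]; split_ifs <;> simp
    simp only [Finset.sum_const, Finset.card_univ, Fintype.card_fin, smul_eq_mul] at this
    omega
  · rw [hout]
    refine if_congr ?_ rfl rfl
    rw [mem_gridCode, ← e.forall_congr_right, Prod.forall]
    have key : ∀ a b c : Fin 2, a + (b + c) = 0 ↔ a = b + c := by decide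
    have key2 : ∀ a : Fin 2, a = a + a ↔ a = 0 := by decide
    constructor
    · intro h i j
      have h0 := h 0 0 (by simp [F, free])
      simp only [par, Equiv.symm_apply_apply, ne_eq, not_true_eq_false, and_self, if_false,
        List.map_nil, List.sum_nil, add_zero] at h0
      change z (e (i, j)) = z (e (i, 0)) + z (e (0, j))
      rcases eq_or_ne i 0 with rfl | hi
      · rw [h0, zero_add]
      rcases eq_or_ne j 0 with rfl | hj
      · rw [h0, add_zero]
      have := h i j (by simp [F, free, hi, hj])
      simpa [par, hi, hj, key] using this
    · intro h i j hij
      change ∀ i j, z (e (i, j)) = z (e (i, 0)) + z (e (0, j)) at h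
      by_cases hp : i ≠ 0 ∧ j ≠ 0
      · simpa [par, hp.1, hp.2, key] using h i j
      · have hi : i = 0 ∧ j = 0 := by
          simp only [F, free, Finset.mem_filter, Finset.mem_univ, true_and,
            Equiv.symm_apply_apply] at hij
          tauto
        have h00 := (key2 _).mp (h 0 0)
        simp [par, hi.1, hi.2, h00]

/-- A codeword has the form `a i + b j`. Agreement on one row fixes `b`, agreement on one column
fixes `a`; the entries in row and column `0` normalise them. -/
theorem gridCode_eq_of_agree {k : ℕ} [NeZero k] {z w : Fin (k * k) → Fin 2}
    (hz : z ∈ gridCode k) (hw : w ∈ gridCode k) (i₀ j₀ : Fin k)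
    (hi : ∀ j, z (finProdFinEquiv (i₀, j)) = w (finProdFinEquiv (i₀, j)))
    (hj : ∀ i, z (finProdFinEquiv (i, j₀)) = w (finProdFinEquiv (i, j₀))) : z = w := by
  rw [mem_gridCode] at hz hw
  have hrow : ∀ j, z (finProdFinEquiv (0, j)) = w (finProdFinEquiv (0, j)) := fun j => by
    have := hi j
    rw [hz, hw, hi 0] at this
    exact add_left_cancel this
  have hcol : ∀ i, z (finProdFinEquiv (i, 0)) = w (finProdFinEquiv (i, 0)) := fun i => by
    have := hj i
    rw [hz, hw, hj 0] at this
    exact add_right_cancel this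
  ext1 m
  obtain ⟨⟨i, j⟩, rfl⟩ := finProdFinEquiv.surjective m
  rw [hz, hw, hrow, hcol]

/-- Flipping the rows (or columns) met by a set shows that the fibres over that set are small. -/
theorem card_gridCode_filter_mul_le {k : ℕ} [NeZero k] (ρ : Fin (k * k) → Fin k)
    (hρ : ∀ z ∈ gridCode k, ∀ b : Fin k → Fin 2, b 0 = 0 →
      (fun m => z m + b (ρ m)) ∈ gridCode k)
    (A : Finset (Fin (k * k))) (w : Fin (k * k) → Fin 2) :
    ((gridCode k).filter fun z => ∀ m ∈ A, z m = w m).card * 2 ^ ((A.image ρ).erase 0).card ≤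
      (gridCode k).card := by
  -- Index `0` is excluded because adding `b` row by row preserves the code only when `b 0 = 0`, and
  -- likewise for columns.
  set R := (A.image ρ).erase 0
  have hcard : 2 ^ R.card = (Finset.univ : Finset ({i // i ∈ R} → Fin 2)).card := by
    simp
  rw [hcard, ← Finset.card_product]
  let b : ({i // i ∈ R} → Fin 2) → Fin k → Fin 2 := fun β i => if h : i ∈ R then β ⟨i, h⟩ else 0
  -- All words of the fibre agree with `w` on `A`, so the flips can be read off at points of `A`,
  -- one in each flipped line; then the word itself is recovered.
  refine Finset.card_le_card_of_injOn (fun q m => q.1 m + b q.2 (ρ m)) ?_ ?_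
  · intro q hq
    simp only [Finset.coe_product, Set.mem_prod, Finset.mem_coe, Finset.mem_filter] at hq
    exact hρ q.1 hq.1.1 (b q.2) (by simp [b, R])
  · rintro ⟨z, β⟩ hq ⟨z', β'⟩ hq' heq
    simp only [Finset.coe_product, Set.mem_prod, Finset.mem_coe, Finset.mem_filter] at hq hq'
    have hβ : β = β' := by
      ext1 ⟨i, hi⟩
      obtain ⟨m, hm, rfl⟩ := Finset.mem_image.mp (Finset.mem_of_mem_erase hi)
      have := congrFun heq m
      simp only [hq.1.2 m hm, hq'.1.2 m hm, b, hi, dif_pos] at this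
      exact add_left_cancel this
    subst hβ
    congr 1
    ext1 m
    exact add_right_cancel (congrFun heq m)

theorem card_gridCode_filter_rows {k : ℕ} [NeZero k] (A : Finset (Fin (k * k)))
    (w : Fin (k * k) → Fin 2) :
    ((gridCode k).filter fun z => ∀ m ∈ A, z m = w m).card *
      2 ^ ((A.image fun m => (finProdFinEquiv.symm m).1).erase 0).card ≤ (gridCode k).card :=
  card_gridCode_filter_mul_le _ (fun z hz b hb => by
    rw [mem_gridCode] at hz ⊢
    intro i j
    simp only [Equiv.symm_apply_apply, hb, add_zero]
    rw [hz i j, add_right_comm]) A w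

theorem card_gridCode_filter_cols {k : ℕ} [NeZero k] (A : Finset (Fin (k * k)))
    (w : Fin (k * k) → Fin 2) :
    ((gridCode k).filter fun z => ∀ m ∈ A, z m = w m).card *
      2 ^ ((A.image fun m => (finProdFinEquiv.symm m).2).erase 0).card ≤ (gridCode k).card :=
  card_gridCode_filter_mul_le _ (fun z hz b hb => by
    rw [mem_gridCode] at hz ⊢
    intro i j
    simp only [Equiv.symm_apply_apply, hb, add_zero]
    rw [hz i j, add_assoc]) A w

/-- A set inside the product of its row and column projections, with at least `r²` points, meets `r`
rows or `r` columns. One of these may be line `0`, which costs the `-1` in the exponent. -/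
theorem card_gridCode_filter_le {k r : ℕ} [NeZero k] (A : Finset (Fin (k * k)))
    (hA : r * r ≤ A.card) (w : Fin (k * k) → Fin 2) :
    ((gridCode k).filter fun z => ∀ m ∈ A, z m = w m).card * 2 ^ (r - 1) ≤
      (gridCode k).card := by
  set R := A.image fun m => (finProdFinEquiv.symm m).1
  set C := A.image fun m => (finProdFinEquiv.symm m).2
  have hRC : A.card ≤ R.card * C.card := by
    rw [← Finset.card_product]
    refine Finset.card_le_card_of_injOn (fun m => finProdFinEquiv.symm m) (fun m hm => ?_)
      (finProdFinEquiv.symm.injective.injOn)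
    exact Finset.mem_coe.mpr (Finset.mem_product.mpr
      ⟨Finset.mem_image_of_mem _ hm, Finset.mem_image_of_mem _ hm⟩)
  have hor : r ≤ R.card ∨ r ≤ C.card := by
    by_contra! h
    exact absurd (hA.trans hRC) (not_le.mpr (Nat.mul_lt_mul'' h.1 h.2))
  rcases hor with h | h
  · refine le_trans ?_ (card_gridCode_filter_rows A w)
    gcongr
    · norm_num
    · exact (Nat.sub_le_sub_right h 1).trans Finset.pred_card_le_card_erase
  · refine le_trans ?_ (card_gridCode_filter_cols A w)
    gcongr
    · norm_num
    · exact (Nat.sub_le_sub_right h 1).trans Finset.pred_card_le_card_erase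

/-- States with short circuits that have high entanglement across every cut in which the number of
qubits on one side lies in a certain window. -/
theorem exists_highly_entangled (r : ℕ) :
    ∃ φ : QState ((2 * (r * r) + 1) * (2 * (r * r) + 1)),
      (∃ gates : List (Gate ((2 * (r * r) + 1) * (2 * (r * r) + 1))),
        gates.length ≤ 3 * ((2 * (r * r) + 1) * (2 * (r * r) + 1)) ∧
          φ.1 = circuitOutput gates) ∧
      ∀ (N : ℕ) (f : Fin ((2 * (r * r) + 1) * (2 * (r * r) + 1)) ↪ Fin N) (A : Finset (Fin N)),
        r * r ≤ (Finset.univ.filter fun m => f m ∈ A).card →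
        (Finset.univ.filter fun m => f m ∈ A).card ≤ 2 * (r * r) →
        BiproductOverlapLE A (placeVec f φ.1) (Real.sqrt ((1 / 2) ^ (r - 1))) := by
  set k := 2 * (r * r) + 1 with hk
  obtain ⟨gates, c, hlen, hout⟩ := exists_circuit_gridCode k
  refine ⟨⟨circuitOutput gates, norm_circuitOutput gates⟩, ⟨gates, hlen, rfl⟩, ?_⟩
  intro N f A h1 h2
  set B : Finset (Fin (k * k)) := Finset.univ.filter fun m => f m ∈ A with hB
  -- The side `k = 2 r² + 1` is chosen so that at most `2 r²` points cannot meet every row or every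
  -- column.
  have hfree : ∀ ρ : Fin (k * k) → Fin k, ∃ i, i ∉ B.image ρ := by
    intro ρ
    by_contra! h
    have h3 : (Finset.univ : Finset (Fin k)).card ≤ (B.image ρ).card :=
      Finset.card_le_card fun i _ => h i
    have h4 := Finset.card_image_le (s := B) (f := ρ)
    rw [Finset.card_univ, Fintype.card_fin] at h3
    omega
  have hfilter : ∀ w : Fin (k * k) → Fin 2,
      ((gridCode k).filter fun z => ∀ m, f m ∈ A → z m = w m) =
        (gridCode k).filter fun z => ∀ m ∈ B, z m = w m := by
    intro w
    simp [hB]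
  refine biproductOverlapLE_placeVec (gridCode k) c _ hout (norm_circuitOutput gates) f A
    ((gridCode k).card / 2 ^ (r - 1)) (r - 1) ?_ ?_ (Nat.div_mul_le_self _ _)
  · intro w _
    rw [Nat.le_div_iff_mul_le (by positivity), hfilter]
    exact card_gridCode_filter_le B h1 w
  · intro w hw z hz h
    obtain ⟨i₀, hi⟩ := hfree fun m => (finProdFinEquiv.symm m).1
    obtain ⟨j₀, hj⟩ := hfree fun m => (finProdFinEquiv.symm m).2
    refine gridCode_eq_of_agree hz hw i₀ j₀ (fun j => h _ fun hA => hi ?_)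
      (fun i => h _ fun hA => hj ?_)
    · exact Finset.mem_image.mpr ⟨_, Finset.mem_filter.mpr ⟨Finset.mem_univ _, hA⟩, by simp⟩
    · exact Finset.mem_image.mpr ⟨_, Finset.mem_filter.mpr ⟨Finset.mem_univ _, hA⟩, by simp⟩

/-! ### Subcubic trees -/

/-- The graph on `0, …, 2 M - 1` in which `v ≥ 1` is joined to `v / 2`. -/
def heapGraph (M : ℕ) : SimpleGraph (Fin (2 * M)) where
  Adj u v := u ≠ v ∧ (v.val / 2 = u.val ∨ u.val / 2 = v.val)
  symm := ⟨fun _ _ h => ⟨h.1.symm, h.2.symm⟩⟩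
  loopless := ⟨fun _ h => h.1 rfl⟩

theorem heapGraph_adj {M : ℕ} {u v : Fin (2 * M)} :
    (heapGraph M).Adj u v ↔ u.val ≠ v.val ∧ (v.val / 2 = u.val ∨ u.val / 2 = v.val) := by
  rw [heapGraph]
  simp [Fin.ext_iff]

theorem heapGraph_isTree {M : ℕ} (hM : 1 ≤ M) : (heapGraph M).IsTree := by
  rw [SimpleGraph.isTree_iff_connected_and_card]
  have hreach : ∀ n (h : n < 2 * M), (heapGraph M).Reachable ⟨n, h⟩ ⟨0, by omega⟩ := by
    intro n
    induction n using Nat.strong_induction_on with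
    | _ n ih =>
      intro h
      rcases Nat.eq_zero_or_pos n with rfl | h0
      · exact SimpleGraph.Reachable.refl _
      · have hadj : (heapGraph M).Adj ⟨n, h⟩ ⟨n / 2, by omega⟩ :=
          heapGraph_adj.mpr ⟨by simp only; omega, Or.inr rfl⟩
        exact hadj.reachable.trans (ih (n / 2) (by omega) (by omega))
  constructor
  · have : Nonempty (Fin (2 * M)) := ⟨⟨0, by omega⟩⟩
    exact ⟨fun u v => (hreach u.1 u.2).trans (hreach v.1 v.2).symm⟩
  · let half : Fin (2 * M) → Fin (2 * M) := fun v => ⟨v.val / 2, by omega⟩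
    -- Each edge is `{v, v / 2}` for a unique nonzero `v`, so there is one edge fewer than there are
    -- vertices.
    have himg : (heapGraph M).edgeSet = (fun v => s(v, half v)) '' {⟨0, by omega⟩}ᶜ := by
      ext e
      induction e with | _ u v => ?_
      simp only [SimpleGraph.mem_edgeSet, heapGraph_adj, Set.mem_image, Set.mem_compl_iff,
        Set.mem_singleton_iff, Sym2.eq_iff, Fin.ext_iff, half]
      constructor
      · rintro ⟨h, h1 | h1⟩
        · exact ⟨v, by omega, Or.inr ⟨rfl, h1⟩⟩
        · exact ⟨u, by omega, Or.inl ⟨rfl, h1⟩⟩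
      · rintro ⟨w, hw, ⟨h1, h2⟩ | ⟨h1, h2⟩⟩ <;> omega
    rw [Nat.card_coe_set_eq, himg, Set.InjOn.ncard_image, Set.ncard_compl, Set.ncard_singleton,
      Nat.card_eq_fintype_card, Fintype.card_fin]
    · omega
    · intro v hv w hw h
      simp only [Set.mem_compl_iff, Set.mem_singleton_iff, Fin.ext_iff] at hv hw
      simp only [Sym2.eq_iff, Fin.ext_iff, half] at h
      exact Fin.ext (by omega)

theorem ncard_neighborSet_heapGraph {M : ℕ} (u : Fin (2 * M)) :
    ((heapGraph M).neighborSet u).ncard = if u.val = 0 ∨ M ≤ u.val then 1 else 3 := by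
  split_ifs with h
  · rw [Set.ncard_eq_one]
    by_cases h0 : u.val = 0
    · refine ⟨⟨1, by omega⟩, ?_⟩
      ext v
      simp only [SimpleGraph.mem_neighborSet, heapGraph_adj, Set.mem_singleton_iff, Fin.ext_iff]
      omega
    · refine ⟨⟨u.val / 2, by omega⟩, ?_⟩
      ext v
      simp only [SimpleGraph.mem_neighborSet, heapGraph_adj, Set.mem_singleton_iff, Fin.ext_iff]
      omega
  · rw [Set.ncard_eq_three]
    refine ⟨⟨u.val / 2, by omega⟩, ⟨2 * u.val, by omega⟩, ⟨2 * u.val + 1, by omega⟩, ?_, ?_, ?_, ?_⟩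
    · simp only [ne_eq, Fin.ext_iff]; omega
    · simp only [ne_eq, Fin.ext_iff]; omega
    · simp only [ne_eq, Fin.ext_iff]; omega
    · ext v
      simp only [SimpleGraph.mem_neighborSet, heapGraph_adj, Set.mem_singleton_iff,
        Set.mem_insert_iff, Fin.ext_iff]
      omega

/-- The heap graph on `2 M` vertices has the `M + 1` leaves `0` and `M, …, 2 M - 1`, all others
having a parent and two children; hence `M = N - 1`. -/
theorem nonempty_subcubicTree {N : ℕ} (hN : 2 ≤ N) : Nonempty (SubcubicTree N) := by
  obtain ⟨M, rfl⟩ : ∃ M, N = M + 1 := ⟨N - 1, by omega⟩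
  refine ⟨⟨2 * M, heapGraph M, heapGraph_isTree (by omega), fun v => ?_,
    fun i => ⟨if i.val = 0 then 0 else M - 1 + i.val, by split_ifs <;> omega⟩, ?_, fun v => ?_⟩⟩
  · rw [ncard_neighborSet_heapGraph]
    split_ifs <;> simp
  · intro i j h
    simp only [Fin.mk.injEq] at h
    split_ifs at h <;> exact Fin.ext (by omega)
  · rw [ncard_neighborSet_heapGraph]
    simp only [Set.mem_range, Fin.ext_iff]
    constructor
    · rintro ⟨i, hi⟩
      rw [if_pos]
      split_ifs at hi <;> omega
    · intro h
      have hv : v.val = 0 ∨ M ≤ v.val := by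
        by_contra h'
        rw [if_neg h'] at h
        omega
      by_cases h0 : v.val = 0
      · exact ⟨⟨0, by omega⟩, by simp [h0]⟩
      · refine ⟨⟨v.val - (M - 1), by omega⟩, ?_⟩
        simp only
        split_ifs <;> omega

/-! ### Components left by deleting an edge -/

section Separation

variable {V : Type*} {G : SimpleGraph V}

theorem reachable_deleteEdges_induction {e : Set (Sym2 V)} {u : V} {Q : V → Prop} (h0 : Q u)
    (hstep : ∀ x y, (G.deleteEdges e).Reachable u x → (G.deleteEdges e).Adj x y → Q x → Q y)
    {x : V} (hx : (G.deleteEdges e).Reachable u x) : Q x := by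
  rw [SimpleGraph.reachable_iff_reflTransGen] at hx
  induction hx with
  | refl => exact h0
  | tail h1 h2 ih =>
    exact hstep _ _ ((SimpleGraph.reachable_iff_reflTransGen _ _).mpr h1) h2 ih

/-- Along a walk from `u`, only the deleted edge can break reachability, and crossing it lands on
one of its endpoints, where reachability starts afresh. -/
theorem reachable_deleteEdges_or (hG : G.Connected) (u v x : V) :
    (G.deleteEdges {s(u, v)}).Reachable u x ∨ (G.deleteEdges {s(u, v)}).Reachable v x := by
  have hx := (SimpleGraph.reachable_iff_reflTransGen _ _).mp (hG.preconnected u x)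
  induction hx with
  | refl => exact Or.inl (SimpleGraph.Reachable.refl _)
  | @tail x y _ h2 ih =>
    by_cases he : s(x, y) = s(u, v)
    · rcases Sym2.eq_iff.mp he with ⟨rfl, rfl⟩ | ⟨rfl, rfl⟩
      · exact Or.inr (SimpleGraph.Reachable.refl _)
      · exact Or.inl (SimpleGraph.Reachable.refl _)
    · have hadj : (G.deleteEdges {s(u, v)}).Adj x y := by
        rw [SimpleGraph.deleteEdges_adj]; exact ⟨h2, he⟩
      exact ih.imp (·.trans hadj.reachable) (·.trans hadj.reachable)

/-- The component of `v` after deleting the edge `vw` consists of `v` and the components of the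
other neighbours of `v`. -/
theorem eq_or_reachable_neighbor {v w x : V}
    (hx : (G.deleteEdges {s(v, w)}).Reachable v x) :
    x = v ∨ ∃ u, G.Adj v u ∧ u ≠ w ∧ (G.deleteEdges {s(u, v)}).Reachable u x := by
  refine reachable_deleteEdges_induction (Q := fun x => x = v ∨ ∃ u, G.Adj v u ∧ u ≠ w ∧
    (G.deleteEdges {s(u, v)}).Reachable u x) (Or.inl rfl) (fun x y _ hxy hq => ?_) hx
  rw [SimpleGraph.deleteEdges_adj] at hxy
  rcases hq with rfl | ⟨u, hvu, huw, hux⟩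
  · exact Or.inr ⟨y, hxy.1, fun h => hxy.2 (by rw [h]; rfl), SimpleGraph.Reachable.refl _⟩
  · by_cases he : s(x, y) = s(u, v)
    · rcases Sym2.eq_iff.mp he with ⟨-, rfl⟩ | ⟨-, rfl⟩
      · exact Or.inl rfl
      · exact Or.inr ⟨y, hvu, huw, SimpleGraph.Reachable.refl _⟩
    · refine Or.inr ⟨u, hvu, huw, hux.trans (SimpleGraph.Adj.reachable ?_)⟩
      rw [SimpleGraph.deleteEdges_adj]
      exact ⟨hxy.1, he⟩

theorem not_reachable_of_isAcyclic (hG : G.IsAcyclic) {u v : V} (h : G.Adj u v) :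
    ¬ (G.deleteEdges {s(u, v)}).Reachable u v :=
  SimpleGraph.isBridge_iff.mp
    (SimpleGraph.isAcyclic_iff_forall_isBridge.mp hG (SimpleGraph.mem_edgeSet _ |>.mpr h))

/-- Since `uv` is a bridge, the branch at `u` never contains `v` and so never uses the edge `vw`.
This gives the nesting of branches needed for a minimality argument. -/
theorem reachable_mono_of_isAcyclic (hG : G.IsAcyclic) {u v w x : V} (hvu : G.Adj v u)
    (huw : u ≠ w) (hx : (G.deleteEdges {s(u, v)}).Reachable u x) :
    (G.deleteEdges {s(v, w)}).Reachable v x := by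
  refine reachable_deleteEdges_induction (Q := fun x => (G.deleteEdges {s(v, w)}).Reachable v x)
    ?_ (fun x y hux hxy hq => ?_) hx
  · refine SimpleGraph.Adj.reachable ?_
    rw [SimpleGraph.deleteEdges_adj]
    refine ⟨hvu, fun h => ?_⟩
    rcases Sym2.eq_iff.mp h with ⟨-, h⟩ | ⟨-, h⟩
    · exact huw h
    · exact hvu.ne h.symm
  · have hnr := not_reachable_of_isAcyclic hG hvu.symm
    have huy := hux.trans hxy.reachable
    rw [SimpleGraph.deleteEdges_adj] at hxy
    refine hq.trans (SimpleGraph.Adj.reachable ?_)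
    rw [SimpleGraph.deleteEdges_adj]
    refine ⟨hxy.1, fun h => ?_⟩
    rcases Sym2.eq_iff.mp h with ⟨rfl, -⟩ | ⟨-, rfl⟩
    · exact hnr hux
    · exact hnr huy

end Separation

theorem SubcubicTree.mem_side {N : ℕ} (T : SubcubicTree N) (d : T.graph.Dart) (j : Fin N) :
    j ∈ T.side d ↔ (T.graph.deleteEdges {s(d.fst, d.snd)}).Reachable d.fst (T.leaf j) := by
  classical
  rw [SubcubicTree.side, Finset.mem_filter]
  simp only [Finset.mem_univ, true_and]
  rfl

/-- Every subcubic tree has an edge that cuts off between `t` and `2 t` elements of a given set of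
leaves. -/
theorem SubcubicTree.exists_balanced {N n t : ℕ} (T : SubcubicTree N) (f : Fin n ↪ Fin N)
    (ht : 1 ≤ t) (hn : 2 * t ≤ n) :
    ∃ d : T.graph.Dart, t ≤ (Finset.univ.filter fun m => f m ∈ T.side d).card ∧
      (Finset.univ.filter fun m => f m ∈ T.side d).card ≤ 2 * t := by
  classical
  set cnt : T.graph.Dart → ℕ := fun d => (Finset.univ.filter fun m => f m ∈ T.side d).card
  set comp : T.graph.Dart → Set (Fin T.size) :=
    fun d => {x | (T.graph.deleteEdges {s(d.fst, d.snd)}).Reachable d.fst x} with hcomp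
  have hmem : ∀ d m, f m ∈ T.side d ↔ T.leaf (f m) ∈ comp d := fun d m => T.mem_side d (f m)
  -- The two sides of any edge cover all leaves, so one side has at least `t` of the `n ≥ 2 t`
  -- marked ones. An edge at a leaf serves as the example.
  obtain ⟨d₀, hd₀⟩ : ∃ d, t ≤ cnt d := by
    have hleaf := (T.mem_range_leaf (T.leaf (f ⟨0, by omega⟩))).mp ⟨_, rfl⟩
    obtain ⟨w, hw⟩ := Set.ncard_eq_one.mp hleaf
    have hadj : T.graph.Adj (T.leaf (f ⟨0, by omega⟩)) w := by
      rw [← SimpleGraph.mem_neighborSet, hw]; rfl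
    let d : T.graph.Dart := ⟨(_, w), hadj⟩
    have hsum : n ≤ cnt d + cnt d.symm := by
      calc n = (Finset.univ : Finset (Fin n)).card := by simp
        _ ≤ ((Finset.univ.filter fun m => f m ∈ T.side d) ∪
            Finset.univ.filter fun m => f m ∈ T.side d.symm).card := by
          refine Finset.card_le_card fun m _ => ?_
          simp only [Finset.mem_union, Finset.mem_filter, Finset.mem_univ, true_and, hmem]
          refine (reachable_deleteEdges_or T.isTree.connected d.fst d.snd
            (T.leaf (f m))).imp id fun h => ?_
          change (T.graph.deleteEdges {s(d.snd, d.fst)}).Reachable d.snd _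
          rwa [Sym2.eq_swap]
        _ ≤ _ := Finset.card_union_le _ _
    by_cases h : t ≤ cnt d
    · exact ⟨d, h⟩
    · exact ⟨d.symm, by omega⟩
  -- Choose the branch with the fewest vertices among those having at least `t` marked leaves. Its
  -- sub-branches are strictly smaller, so each has fewer than `t`, and an inner vertex has only two
  -- of them.
  obtain ⟨d, hd, hmin⟩ : ∃ d, t ≤ cnt d ∧ ∀ d', t ≤ cnt d' → (comp d).ncard ≤ (comp d').ncard := by
    have hex : ∃ c d, t ≤ cnt d ∧ (comp d).ncard = c := ⟨_, d₀, hd₀, rfl⟩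
    obtain ⟨d, hd, hc⟩ := Nat.find_spec hex
    exact ⟨d, hd, fun d' hd' => hc ▸ Nat.find_min' hex ⟨d', hd', rfl⟩⟩
  refine ⟨d, hd, ?_⟩
  change cnt d ≤ 2 * t
  have hsmall : ∀ u (hu : T.graph.Adj u d.fst), u ≠ d.snd → cnt ⟨(u, d.fst), hu⟩ < t := by
    intro u hu hne
    by_contra! h
    refine absurd (hmin _ h) (not_le.mpr (Set.ncard_lt_ncard ?_ (Set.toFinite _)))
    refine ⟨fun x hx => reachable_mono_of_isAcyclic T.isTree.isAcyclic hu.symm hne hx,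
      fun h => ?_⟩
    exact not_reachable_of_isAcyclic T.isTree.isAcyclic hu
      (h (SimpleGraph.Reachable.refl _ : d.fst ∈ comp d))
  have hsplit : ∀ x ∈ comp d, x = d.fst ∨ ∃ u, ∃ hu : T.graph.Adj u d.fst, u ≠ d.snd ∧
      x ∈ comp ⟨(u, d.fst), hu⟩ := fun x hx =>
    (eq_or_reachable_neighbor hx).imp id fun ⟨u, hu, hne, h⟩ => ⟨u, hu.symm, hne, h⟩
  have hsnd : d.snd ∈ T.graph.neighborSet d.fst := d.adj
  rcases T.degree_eq d.fst with h1 | h3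
  · have hle : cnt d ≤ 1 := by
      refine Finset.card_le_one.mpr fun m hm m' hm' => ?_
      have hroot : ∀ x ∈ comp d, x = d.fst := by
        intro x hx
        rcases hsplit x hx with h | ⟨u, hu, hne, -⟩
        · exact h
        · obtain ⟨w, hw⟩ := Set.ncard_eq_one.mp h1
          have hu' : u ∈ T.graph.neighborSet d.fst := hu.symm
          rw [hw] at hsnd hu'
          exact absurd (hu'.trans hsnd.symm) hne
      simp only [Finset.mem_filter, Finset.mem_univ, true_and, hmem] at hm hm'
      exact f.injective (T.leaf_injective ((hroot _ hm).trans (hroot _ hm').symm))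
    omega
  · have h2 : (T.graph.neighborSet d.fst \ {d.snd}).ncard = 2 := by
      rw [Set.ncard_sdiff_singleton_of_mem hsnd, h3]
    obtain ⟨u₁, u₂, -, hu⟩ := Set.ncard_eq_two.mp h2
    have hu₁ : u₁ ∈ T.graph.neighborSet d.fst \ {d.snd} := by rw [hu]; simp
    have hu₂ : u₂ ∈ T.graph.neighborSet d.fst \ {d.snd} := by rw [hu]; simp
    have hlt₁ := hsmall u₁ hu₁.1.symm hu₁.2
    have hlt₂ := hsmall u₂ hu₂.1.symm hu₂.2
    have hle : cnt d ≤ cnt ⟨(u₁, d.fst), hu₁.1.symm⟩ + cnt ⟨(u₂, d.fst), hu₂.1.symm⟩ := by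
      refine (Finset.card_le_card fun m hm => ?_).trans (Finset.card_union_le _ _)
      simp only [Finset.mem_union, Finset.mem_filter, Finset.mem_univ, true_and, hmem] at hm ⊢
      rcases hsplit _ hm with h | ⟨u, hu', hne, hx⟩
      · have := (T.mem_range_leaf d.fst).mp ⟨_, h⟩
        omega
      · have hmemu : u ∈ T.graph.neighborSet d.fst \ {d.snd} := ⟨hu'.symm, hne⟩
        rw [hu] at hmemu
        rcases hmemu with rfl | rfl
        · exact Or.inl hx
        · exact Or.inr hx
    omega

/-! ### Blocks of a chain -/

/-- Some initial block of the chain contains exactly `t` elements of a given set of qubits. -/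
theorem exists_block_card_eq {N n t : ℕ} (f : Fin n ↪ Fin N) (hn : t ≤ n) :
    ∃ L ≤ N, (Finset.univ.filter fun m => f m ∈ block N 0 L).card = t := by
  set cnt : ℕ → ℕ := fun L => (Finset.univ.filter fun m => f m ∈ block N 0 L).card with hcnt
  have hmem : ∀ m L, f m ∈ block N 0 L ↔ (f m).val < L := fun m L => by simp [block]
  have hN : cnt N = n := by
    simp only [hcnt, hmem, Fin.is_lt, Finset.filter_true, Finset.card_univ, Fintype.card_fin]
  have hstep : ∀ L, cnt (L + 1) ≤ cnt L + 1 := by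
    intro L
    have hsub : (Finset.univ.filter fun m => f m ∈ block N 0 (L + 1)) ⊆
        (Finset.univ.filter fun m => f m ∈ block N 0 L) ∪
          Finset.univ.filter fun m => (f m).val = L := by
      intro m hm
      simp only [Finset.mem_union, Finset.mem_filter, Finset.mem_univ, true_and, hmem] at hm ⊢
      omega
    refine (Finset.card_le_card hsub).trans ((Finset.card_union_le _ _).trans ?_)
    refine Nat.add_le_add_left (Finset.card_le_one.mpr fun m hm m' hm' => ?_) _
    simp only [Finset.mem_filter, Finset.mem_univ, true_and] at hm hm'
    exact f.injective (Fin.ext (hm.trans hm'.symm))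
  -- Discrete continuity: the count rises by at most one per site, so the first `L` that reaches `t`
  -- hits it exactly.
  have hex : ∃ L, t ≤ cnt L := ⟨N, by omega⟩
  have hle : Nat.find hex ≤ N := Nat.find_min' hex (by omega)
  refine ⟨Nat.find hex, hle, le_antisymm ?_ (Nat.find_spec hex)⟩
  change cnt (Nat.find hex) ≤ t
  rcases Nat.eq_zero_or_pos (Nat.find hex) with h0 | h0
  · rw [h0]
    simp [hcnt, hmem]
  · have h1 := Nat.find_min hex (Nat.sub_lt h0 one_pos)
    have h2 := hstep (Nat.find hex - 1)
    rw [Nat.sub_add_cancel h0] at h2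
    omega

theorem card_filter_block_le {N n : ℕ} (f : Fin n ↪ Fin N) (L : ℕ) :
    (Finset.univ.filter fun m => f m ∈ block N 0 L).card ≤ L := by
  have h : ((Finset.univ.filter fun m => f m ∈ block N 0 L).image fun m => (f m).val) ⊆
      Finset.range L := by
    intro i hi
    obtain ⟨m, hm, rfl⟩ := Finset.mem_image.mp hi
    simpa [block] using hm
  have hinj : Function.Injective fun m => (f m).val := Fin.val_injective.comp f.injective
  rw [← Finset.card_image_of_injective _ hinj]
  simpa using Finset.card_le_card h

/-! ### GHZ states and localizable entanglement -/

/-- Sequential composition of protocols. -/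
def Protocol.seq {N : ℕ} : Protocol N → Protocol N → Protocol N
  | .done, Q => Q
  | .round m I next, Q => .round m I fun o => (next o).seq Q

/-- Branches reach their target only up to a scalar, so sequential composition needs homogeneity. -/
theorem Protocol.Transforms.smul {N : ℕ} {P : Protocol N} {v t : Vec N} (h : P.Transforms v t)
    (c : ℂ) : P.Transforms (c • v) t := by
  induction P generalizing v with
  | done =>
    obtain ⟨d, rfl⟩ := h
    exact ⟨c * d, smul_smul _ _ _⟩
  | round m I next ih =>
    intro o
    rw [applyLocal_smul]
    exact ih o (h o)

theorem Protocol.Transforms.seq {N : ℕ} {P Q : Protocol N} {v t u : Vec N}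
    (hP : P.Transforms v t) (hQ : Q.Transforms t u) : (P.seq Q).Transforms v u := by
  induction P generalizing v with
  | done =>
    obtain ⟨d, rfl⟩ := hP
    exact hQ.smul d
  | round m I next ih => exact fun o => ih o (hP o)

theorem tensorVec_smul {N : ℕ} (p : Fin N → ℂ) (α : Fin N → Fin 2 → ℂ) :
    tensorVec (fun j => p j • α j) = (∏ j, p j) • tensorVec α := by
  ext x
  simp [tensorVec, Finset.prod_mul_distrib]

/-- The unnormalised vector `|0⋯0⟩ + σ |1⋯1⟩` on the qubits of `X`, with `|0⟩` elsewhere. -/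
def catVec {N : ℕ} (X : Finset (Fin N)) (σ : ℂ) : Vec N :=
  tensorVec (fun _ => Pi.single 0 1) +
    σ • tensorVec (fun j => if j ∈ X then Pi.single 1 1 else Pi.single 0 1)

theorem placeVec_eq_catVec {n N : ℕ} (f : Fin (n + 1) ↪ Fin N) (φ : Vec (n + 1)) (c : ℂ)
    (hφ : ∀ x, φ x = if ∀ k, x k = x 0 then c else 0) :
    placeVec f φ = c • catVec (Finset.univ.map f) 1 := by
  classical
  have h0 : tensorVec (fun _ : Fin N => Pi.single 0 1) =
      (EuclideanSpace.single (fun _ => 0) 1 : Vec N) := (single_eq_tensorVec _).symm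
  have h1 : tensorVec (fun j : Fin N =>
      if j ∈ Finset.univ.map f then Pi.single 1 1 else Pi.single 0 1) =
      (EuclideanSpace.single (fun j => if j ∈ Finset.univ.map f then 1 else 0) 1 : Vec N) := by
    rw [single_eq_tensorVec]
    congr 1
    ext1 j
    split_ifs <;> rfl
  have hrange : ∀ j, j ∈ Finset.univ.map f ↔ j ∈ Set.range f := by simp
  rw [catVec, h0, h1]
  ext x
  simp only [placeVec, hφ, PiLp.smul_apply, PiLp.add_apply, one_smul, PiLp.single_apply, smul_eq_mul]
  have hfin : ∀ y : Fin 2, y = 0 ∨ y = 1 := by decide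
  have hA : (∀ j, j ∉ Set.range f → x j = 0) → (∀ k, x (f k) = x (f 0)) → x (f 0) = 0 →
      x = fun _ => 0 := by
    intro ha hb hc
    ext1 j
    by_cases hj : j ∈ Set.range f
    · obtain ⟨k, rfl⟩ := hj
      rw [hb, hc]
    · exact ha j hj
  have hB : (∀ j, j ∉ Set.range f → x j = 0) → (∀ k, x (f k) = x (f 0)) → x (f 0) = 1 →
      x = fun j => if j ∈ Finset.univ.map f then 1 else 0 := by
    intro ha hb hc
    ext1 j
    by_cases hj : j ∈ Set.range f
    · rw [if_pos ((hrange j).mpr hj)]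
      obtain ⟨k, rfl⟩ := hj
      rw [hb, hc]
    · rw [if_neg fun h => hj ((hrange j).mp h)]
      exact ha j hj
  by_cases hx0 : x = fun _ => 0
  · have hne : x ≠ fun j => if j ∈ Finset.univ.map f then 1 else 0 := by
      intro h
      have := congrFun h (f 0)
      rw [hx0] at this
      simp at this
    rw [if_pos hx0, if_neg hne]
    simp [hx0]
  · rw [if_neg hx0]
    by_cases hx1 : x = fun j => if j ∈ Finset.univ.map f then 1 else 0
    · rw [if_pos hx1, hx1, if_pos, if_pos]
      · simp
      · simp
      · intro j hj
        exact if_neg fun h => hj ((hrange j).mp h)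
    · rw [if_neg hx1]
      split_ifs with ha hb
      · rcases hfin (x (f 0)) with h | h
        · exact absurd (hA ha hb h) hx0
        · exact absurd (hB ha hb h) hx1
      all_goals simp

/-- Measurement in the basis `(|0⟩ ± |1⟩)/√2` followed by a reset to `|0⟩`. -/
def resetInstrument : Instrument 2 where
  kraus o := (Real.sqrt 2 : ℂ)⁻¹ • !![1, if o = 0 then 1 else -1; 0, 0]
  complete := by
    rw [Fin.sum_univ_two]
    ext i j
    fin_cases i <;> fin_cases j <;>
      simp [Matrix.mul_apply, Fin.sum_univ_two, inv_sqrt_two_sq] <;> norm_num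

/-- The trivial instrument with a second outcome that never occurs. -/
def trivialInstrument : Instrument 2 where
  kraus o := if o = 0 then 1 else 0
  complete := by simp

/-- Multiplication of `|1⟩` by a sign. -/
def phaseInstrument (σ : ℂ) (hσ : star σ * σ = 1) : Instrument 1 where
  kraus _ := !![1, 0; 0, σ]
  complete := by
    ext i j
    have h : (starRingEnd ℂ) σ * σ = 1 := hσ
    fin_cases i <;> fin_cases j <;> simp [Matrix.mul_apply, Fin.sum_univ_two, h]

/-- The instrument that does nothing. -/
def idInstrument : Instrument 1 where
  kraus _ := 1
  complete := by simp

/-- Measuring a qubit of `X` in the basis `|±⟩` removes it and multiplies the `|1⋯1⟩` term by a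
sign. The product `σ` of the signs is known to all parties and undone by a phase on `a`. All
instruments of a round share the outcome type, hence the padded trivial instrument on the unmeasured
qubits. -/
theorem exists_protocol_catVec {N : ℕ} (X : Finset (Fin N)) {a b : Fin N} (ha : a ∈ X)
    (hb : b ∈ X) (hab : a ≠ b) : ∃ P : Protocol N, P.Transforms (catVec X 1) (catVec {a, b} 1) := by
  let sgn : Fin 2 → ℂ := fun o => if o = 0 then 1 else -1
  have hsgn : ∀ o, star (sgn o) * sgn o = 1 := by
    intro o
    simp only [sgn]
    split_ifs <;> simp
  have hsgn2 : ∀ o, sgn o * sgn o = 1 := by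
    intro o
    simp only [sgn]
    split_ifs <;> simp
  let meas : Fin N → Prop := fun j => j ∈ X ∧ j ≠ a ∧ j ≠ b
  have : DecidablePred meas := fun j => by simp only [meas]; infer_instance
  let σ : (Fin N → Fin 2) → ℂ := fun o => ∏ j, if meas j then sgn (o j) else 1
  have hσ : ∀ o, star (σ o) * σ o = 1 := by
    intro o
    simp only [σ]
    rw [star_prod, ← Finset.prod_mul_distrib]
    refine Finset.prod_eq_one fun j _ => ?_
    split_ifs
    · exact hsgn _
    · simp
  have hσ2 : ∀ o, σ o * σ o = 1 := by
    intro o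
    simp only [σ]
    rw [← Finset.prod_mul_distrib]
    refine Finset.prod_eq_one fun j _ => ?_
    split_ifs
    · exact hsgn2 _
    · simp
  -- The factor that each qubit contributes to the branch; it vanishes when the padded outcome
  -- occurs.
  let p : (Fin N → Fin 2) → Fin N → ℂ := fun o j =>
    if meas j then (Real.sqrt 2 : ℂ)⁻¹ else if o j = 0 then 1 else 0
  refine ⟨.round 2 (fun j => if meas j then resetInstrument else trivialInstrument) fun o =>
    .round 1 (fun j => if j = a then phaseInstrument (σ o) (hσ o) else idInstrument)
      fun _ => .done, fun o o' => ?_⟩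
  have hreset0 : ∀ y, resetInstrument.kraus y *ᵥ Pi.single 0 1 =
      (Real.sqrt 2 : ℂ)⁻¹ • Pi.single 0 1 := by
    intro y
    ext i
    fin_cases i <;> simp [resetInstrument]
  have hreset1 : ∀ y, resetInstrument.kraus y *ᵥ Pi.single 1 1 =
      ((Real.sqrt 2 : ℂ)⁻¹ * sgn y) • Pi.single 0 1 := by
    intro y
    ext i
    fin_cases i <;> simp [resetInstrument, sgn]
  have htriv : ∀ y (w : Fin 2 → ℂ), trivialInstrument.kraus y *ᵥ w =
      (if y = 0 then (1 : ℂ) else 0) • w := by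
    intro y w
    simp only [trivialInstrument]
    split_ifs <;> simp
  have hround1 : applyLocal (fun j => (if meas j then resetInstrument else
      trivialInstrument).kraus (o j)) (catVec X 1) = (∏ j, p o j) • catVec {a, b} (σ o) := by
    rw [catVec, catVec, one_smul, applyLocal_add, smul_add, applyLocal_tensorVec,
      applyLocal_tensorVec, smul_smul, ← tensorVec_smul, ← Finset.prod_mul_distrib,
      ← tensorVec_smul]
    congr 2
    · ext1 j
      by_cases hj : meas j
      · simp only [hj, if_true, p, hreset0]
      · simp only [hj, if_false, p, htriv]
    · ext1 j
      by_cases hj : meas j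
      · obtain ⟨h1, h2, h3⟩ := id hj
        simp only [hj, if_true, p, h1, hreset1]
        simp [h2, h3]
      · simp only [hj, if_false, p, htriv, mul_one]
        congr 1
        refine if_congr ?_ rfl rfl
        simp only [meas, not_and, not_not] at hj
        rw [Finset.mem_insert, Finset.mem_singleton]
        constructor
        · intro h
          by_cases h' : j = a
          · exact Or.inl h'
          · exact Or.inr (hj h h')
        · rintro (rfl | rfl) <;> assumption
  have hround2 : applyLocal (fun j => (if j = a then phaseInstrument (σ o) (hσ o) else
      idInstrument).kraus (o' j)) (catVec {a, b} (σ o)) = catVec {a, b} 1 := by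
    rw [catVec, catVec, applyLocal_add, applyLocal_smul, applyLocal_tensorVec,
      applyLocal_tensorVec]
    have h0 : ∀ j, (if j = a then phaseInstrument (σ o) (hσ o) else
        idInstrument).kraus (o' j) *ᵥ Pi.single 0 1 = Pi.single 0 1 := by
      intro j
      split_ifs
      · ext i
        fin_cases i <;> simp [phaseInstrument]
      · exact Matrix.one_mulVec _
    have h1 : ∀ j, (if j = a then phaseInstrument (σ o) (hσ o) else
        idInstrument).kraus (o' j) *ᵥ
          (if j ∈ ({a, b} : Finset (Fin N)) then Pi.single 1 1 else Pi.single 0 1) =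
        (if j = a then σ o else 1) •
          (if j ∈ ({a, b} : Finset (Fin N)) then Pi.single 1 1 else Pi.single 0 1) := by
      intro j
      by_cases hj : j = a
      · simp only [hj, if_true, Finset.mem_insert, true_or]
        ext i
        fin_cases i <;> simp [phaseInstrument]
      · simp only [hj, if_false, one_smul]
        exact Matrix.one_mulVec _
    simp_rw [h0, h1]
    rw [tensorVec_smul, smul_smul, Finset.prod_ite_eq' Finset.univ a,
      if_pos (Finset.mem_univ a), hσ2]
  exact ⟨∏ j, p o j, by rw [hround1, applyLocal_smul, hround2]⟩

theorem bellVec_apply (x : Fin 2 → Fin 2) :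
    bellVec x = if ∀ k, x k = x 0 then (Real.sqrt 2 : ℂ)⁻¹ else 0 := by
  simp only [bellVec, PiLp.smul_apply, PiLp.add_apply, PiLp.single_apply, smul_eq_mul]
  obtain ⟨y, z, rfl⟩ : ∃ y z, x = ![y, z] := ⟨x 0, x 1, by ext i; fin_cases i <;> rfl⟩
  fin_cases y <;> fin_cases z <;> simp [funext_iff, Fin.forall_fin_two]

theorem le_numLE_of_convertible {n N : ℕ} {f : Fin (n + 1) ↪ Fin N} {ψ : QState N}
    {φ : Vec (n + 1)} (c : ℂ) (hφ : ∀ x, φ x = if ∀ k, x k = x 0 then c else 0)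
    (h : ConvertibleOn f ψ.1 φ) : n + 1 ≤ numLE ψ := by
  -- The bound `N` is needed because `sSup` of an unbounded set of naturals would be `0`.
  refine le_csSup ⟨N, ?_⟩ ⟨Finset.univ.map f, by simp, ?_⟩
  · rintro _ ⟨A, rfl, -⟩
    simpa using A.card_le_univ
  · intro a ha b hb hab
    have hinj : Function.Injective ![a, b] := by
      intro i j hij
      fin_cases i <;> fin_cases j <;> simp_all
    obtain ⟨P, hP⟩ := h
    obtain ⟨Q, hQ⟩ := exists_protocol_catVec _ ha hb hab
    let g : Fin 2 ↪ Fin N := ⟨![a, b], hinj⟩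
    have hg : Finset.univ.map g = {a, b} := by
      ext j
      simp [g, Fin.exists_fin_two, eq_comm]
    have hbell : (catVec {a, b} 1 : Vec N) = (Real.sqrt 2 : ℂ) • placeVec g bellVec := by
      rw [placeVec_eq_catVec g bellVec _ bellVec_apply, hg, smul_smul, mul_inv_cancel₀, one_smul]
      simp
    rw [placeVec_eq_catVec f φ c hφ] at hP
    have hdone : (Protocol.done : Protocol N).Transforms (catVec {a, b} 1)
      (placeVec g bellVec) := ⟨_, hbell⟩
    exact ⟨g, rfl, rfl, _, hP.seq ((hQ.smul c).seq hdone)⟩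

/-- GHZ states have linear-size circuits. -/
theorem exists_circuit_ghz (n : ℕ) :
    ∃ (gates : List (Gate (n + 1))) (c : ℂ), gates.length ≤ 2 * (n + 1) ∧
      ∀ x, circuitOutput gates x = if ∀ k, x k = x 0 then c else 0 := by
  -- Qubit `0` is the only free one and every other qubit copies it.
  obtain ⟨gates, c, hlen, hout⟩ := exists_circuit_parityChecks ({0} : Finset (Fin (n + 1)))
    (fun j => if j = 0 then [] else [0]) (by
      intro j c hc
      split_ifs at hc with h
      · simp at hc
      · simp only [List.mem_singleton] at hc
        simp [hc, h])
  refine ⟨gates, c, hlen.trans ?_, fun x => ?_⟩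
  · have : ∑ j : Fin (n + 1), (if j = 0 then ([] : List (Fin (n + 1))) else [0]).length ≤
        ∑ _j : Fin (n + 1), 1 := Finset.sum_le_sum fun j _ => by split_ifs <;> simp
    simp only [Finset.sum_const, Finset.card_univ, Fintype.card_fin, smul_eq_mul] at this
    omega
  · rw [hout]
    refine if_congr (forall_congr' fun j => ?_) rfl rfl
    have key : ∀ a b : Fin 2, a + b = 0 ↔ a = b := by decide
    by_cases h : j = 0
    · simp [h]
    · simp [h, key]

/-! ### Universality -/

theorem IsEfficientUniversal.isSpatiallyEfficientUniversal {Ψ : Resource}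
    (h : IsEfficientUniversal Ψ) : IsSpatiallyEfficientUniversal Ψ := by
  intro φ hφ
  obtain ⟨p, hp⟩ := h φ hφ
  refine ⟨p, fun n hn => ?_⟩
  obtain ⟨N, ψ, f, P, hψ, hN, -, hP⟩ := hp n hn
  exact ⟨N, ψ, f, hψ, hN, P.toProtocol, hP⟩

open Filter in
/-- The logarithm of a polynomial grows more slowly than any linear function. -/
theorem eventually_mul_log_eval_lt {C : ℝ} (hC : 0 < C) (p : Polynomial ℕ) :
    ∀ᶠ n : ℕ in atTop, C * Real.log (p.eval n : ℕ) < n - 1 := by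
  -- Substituting `n = C x + 1` turns the claim into `P x < exp x` for large `x`.
  set P : Polynomial ℝ := (p.map (Nat.castRingHom ℝ)).comp
    (Polynomial.C C * Polynomial.X + 1) with hP
  have hlin : Tendsto (fun n : ℕ => ((n : ℝ) - 1) / C) atTop atTop :=
    (tendsto_atTop_add_const_right _ (-1) tendsto_natCast_atTop_atTop).atTop_div_const hC
  have hlim := (P.tendsto_div_exp_atTop).comp hlin
  filter_upwards [hlim.eventually_lt_const one_pos, eventually_gt_atTop 1] with n hn hn1
  have heval : P.eval (((n : ℝ) - 1) / C) = (p.eval n : ℕ) := by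
    have h1 : C * (((n : ℝ) - 1) / C) + 1 = n := by field_simp; ring
    rw [hP, Polynomial.eval_comp]
    simp only [Polynomial.eval_add, Polynomial.eval_mul, Polynomial.eval_C, Polynomial.eval_X,
      Polynomial.eval_one, h1]
    rw [Polynomial.eval_natCast_map]
    simp
  simp only [Function.comp_apply] at hn
  rw [heval, div_lt_one (Real.exp_pos _)] at hn
  have hn1' : (1 : ℝ) < n := by exact_mod_cast hn1
  rcases Nat.eq_zero_or_pos (p.eval n) with h0 | h0
  · rw [h0, Nat.cast_zero, Real.log_zero, mul_zero]
    linarith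
  · have := (Real.log_lt_iff_lt_exp (by exact_mod_cast h0)).mpr hn
    rw [lt_div_iff₀ hC] at this
    linarith

/-- Replacing `C` by `|C| + 1` makes the constant positive, so the bound becomes monotone in the
system size whatever the sign of `C`. -/
theorem mul_log_le_mul_log_of_le {C : ℝ} {N M : ℕ} (hN : 1 ≤ N) (hM : N ≤ M) :
    C * Real.log N ≤ (|C| + 1) * Real.log M := by
  have h0 : 0 ≤ Real.log N := Real.log_nonneg (by exact_mod_cast hN)
  have h1 : Real.log N ≤ Real.log M :=
    Real.log_le_log (by exact_mod_cast hN) (by exact_mod_cast hM)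
  calc C * Real.log N ≤ (|C| + 1) * Real.log N :=
        mul_le_mul_of_nonneg_right ((le_abs_self C).trans (by linarith)) h0
    _ ≤ _ := mul_le_mul_of_nonneg_left h1 (by positivity)

/-- The number of qubits of the target states used below. -/
def gridSize (r : ℕ) : ℕ := (2 * (r * r) + 1) * (2 * (r * r) + 1)

theorem gridSize_injective : Function.Injective gridSize := by
  intro r r' h
  have h1 : 2 * (r * r) + 1 = 2 * (r' * r') + 1 := Nat.mul_self_inj.mp h
  exact Nat.mul_self_inj.mp (by omega)

theorem lt_gridSize (r : ℕ) : 2 * (r * r) < gridSize r := by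
  unfold gridSize
  nlinarith [Nat.zero_le (r * r)]

theorem le_gridSize (r : ℕ) : r ≤ gridSize r := by
  have := lt_gridSize r
  nlinarith

/-- Across every cut that separates between `r²` and `2 r²` of the qubits in the range of `f`, the
overlap of `v` with product vectors is exponentially small in `r`. -/
def HighlyEntangledOn {n N : ℕ} (r : ℕ) (f : Fin n ↪ Fin N) (v : Vec N) : Prop :=
  ∀ A : Finset (Fin N), r * r ≤ (Finset.univ.filter fun m => f m ∈ A).card →
    (Finset.univ.filter fun m => f m ∈ A).card ≤ 2 * (r * r) →
      BiproductOverlapLE A v (Real.sqrt ((1 / 2) ^ (r - 1)))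

theorem exists_highly_entangled_family : ∃ φ : ∀ n : ℕ, QState n, PolyPreparable φ ∧
    ∀ (r N : ℕ) (f : Fin (gridSize r) ↪ Fin N),
      HighlyEntangledOn r f (placeVec f (φ (gridSize r)).1) := by
  have h : ∀ n : ℕ, ∃ φ : QState n,
      (∃ gates : List (Gate n), gates.length ≤ 3 * n ∧ φ.1 = circuitOutput gates) ∧
      ∀ (r N : ℕ) (f : Fin n ↪ Fin N), n = gridSize r →
        HighlyEntangledOn r f (placeVec f φ.1) := by
    intro n
    by_cases hn : ∃ r, n = gridSize r
    · obtain ⟨r, rfl⟩ := hn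
      obtain ⟨φ, hc, hφ⟩ := exists_highly_entangled r
      refine ⟨φ, hc, fun r' N f hr => ?_⟩
      obtain rfl := gridSize_injective hr
      exact hφ N f
    · exact ⟨⟨circuitOutput [], norm_circuitOutput []⟩, ⟨[], by simp, rfl⟩,
        fun r N f hr => absurd ⟨r, hr⟩ hn⟩
  choose φ hc hφ using h
  refine ⟨φ, ⟨3 * Polynomial.X, fun n _ => ?_⟩, fun r N f => hφ _ r N f rfl⟩
  simpa using hc n

/-- A resource is not universal if highly entangled states cannot be reached from it with
polynomial overhead. -/
theorem not_isSpatiallyEfficientUniversal_of_bound {Ψ : Resource} (C : ℝ) (N₀ : ℕ)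
    (h : ∀ (r N : ℕ) (ψ : QState N) (f : Fin (gridSize r) ↪ Fin N),
      (⟨N, ψ⟩ : Σ N : ℕ, QState N) ∈ Ψ → 2 ≤ r → N₀ ≤ N → HighlyEntangledOn r f ψ.1 →
        (r : ℝ) - 1 ≤ C * Real.log N) : ¬ IsSpatiallyEfficientUniversal Ψ := by
  intro hΨ
  obtain ⟨φ, hφ, hent⟩ := exists_highly_entangled_family
  obtain ⟨p, hp⟩ := hΨ φ hφ
  -- The overhead as a polynomial in `r`, since the target has `(2 r² + 1)²` qubits.
  set q : Polynomial ℕ := p.comp ((2 * Polynomial.X ^ 2 + 1) ^ 2) with hq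
  have heval : ∀ r, q.eval r = p.eval (gridSize r) := by
    intro r
    simp only [hq, Polynomial.eval_comp, Polynomial.eval_pow, Polynomial.eval_add,
      Polynomial.eval_mul, Polynomial.eval_X, Polynomial.eval_one, Polynomial.eval_ofNat, gridSize]
    congr 1
    ring
  obtain ⟨r, hr, hr2⟩ := ((eventually_mul_log_eval_lt (C := |C| + 1) (by positivity) q).and
    (Filter.eventually_ge_atTop (max 2 N₀))).exists
  have hpos : 1 ≤ gridSize r := (Nat.zero_le _).trans_lt (lt_gridSize r)
  obtain ⟨N, ψ, f, hψ, hN, hconv⟩ := hp (gridSize r) hpos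
  have hle : gridSize r ≤ N := by simpa using Fintype.card_le_of_embedding f
  have h1 := h r N ψ f hψ ((le_max_left _ _).trans hr2)
    (((le_max_right _ _).trans hr2).trans ((le_gridSize r).trans hle)) fun A hA hA' =>
      (hent r N f A hA hA').of_convertible (Real.sqrt_nonneg _)
        ((norm_placeVec f _).trans (φ _).2) hconv
  rw [heval] at hr
  have h2 := mul_log_le_mul_log_of_le (C := C) (hpos.trans hle) hN
  linarith

theorem sqrt_half_pow_pos (s : ℕ) : 0 < Real.sqrt ((1 / 2) ^ s) :=
  Real.sqrt_pos.mpr (by positivity)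

theorem neg_logb_sqrt_half_pow {r : ℕ} (hr : 2 ≤ r) :
    -Real.logb 2 (Real.sqrt ((1 / 2) ^ (r - 1)) ^ 2) = (r : ℝ) - 1 := by
  rw [Real.sq_sqrt (by positivity), one_div, inv_pow, Real.logb_inv, neg_neg, Real.logb_pow,
    Real.logb_self_eq_one (by norm_num), mul_one, Nat.cast_sub (by omega), Nat.cast_one]

/-! ### Lower bounds on the measures of highly entangled states -/

section LowerBounds

variable {r N : ℕ} {ψ : QState N} {f : Fin (gridSize r) ↪ Fin N}

/-- An initial block with exactly `r²` qubits of the range lies in the window. It has length at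
least `r² ≥ 4`, so the block entropy hypothesis applies to it. -/
theorem HighlyEntangledOn.exists_block (h : HighlyEntangledOn r f ψ.1) (hr : 2 ≤ r) :
    ∃ L, 2 ≤ L ∧ L ≤ N ∧
      BiproductOverlapLE (block N 0 L) ψ.1 (Real.sqrt ((1 / 2) ^ (r - 1))) := by
  obtain ⟨L, hL, hcard⟩ := exists_block_card_eq (t := r * r) f (by have := lt_gridSize r; omega)
  refine ⟨L, ?_, hL, h _ hcard.ge (by omega)⟩
  have := card_filter_block_le f L
  nlinarith

theorem HighlyEntangledOn.exists_dart (h : HighlyEntangledOn r f ψ.1) (hr : 2 ≤ r)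
    (T : SubcubicTree N) : ∃ d : T.graph.Dart,
      BiproductOverlapLE (T.side d) ψ.1 (Real.sqrt ((1 / 2) ^ (r - 1))) := by
  obtain ⟨d, h1, h2⟩ := T.exists_balanced (t := r * r) f (by nlinarith) (lt_gridSize r).le
  exact ⟨d, h _ h1 h2⟩

theorem nonempty_subcubicTree_of_embedding (f : Fin (gridSize r) ↪ Fin N) (hr : 2 ≤ r) :
    Nonempty (SubcubicTree N) := by
  have h1 : gridSize r ≤ N := by simpa using Fintype.card_le_of_embedding f
  exact nonempty_subcubicTree (hr.trans ((le_gridSize r).trans h1))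

theorem HighlyEntangledOn.le_entropicWidth (h : HighlyEntangledOn r f ψ.1) (hr : 2 ≤ r) :
    (r : ℝ) - 1 ≤ entropicWidth ψ := by
  rw [← neg_logb_sqrt_half_pow hr]
  refine MQC.le_entropicWidth (nonempty_subcubicTree_of_embedding f hr) fun T => ?_
  obtain ⟨d, hd⟩ := h.exists_dart hr T
  exact ⟨d, hd.le_entanglementEntropy⟩

theorem HighlyEntangledOn.le_schmidtRankWidth (h : HighlyEntangledOn r f ψ.1) (hr : 2 ≤ r) :
    (r : ℝ) - 1 ≤ schmidtRankWidth ψ := by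
  rw [← neg_logb_sqrt_half_pow hr]
  refine MQC.le_schmidtRankWidth (nonempty_subcubicTree_of_embedding f hr) fun T => ?_
  obtain ⟨d, hd⟩ := h.exists_dart hr T
  exact ⟨d, hd.le_logb_schmidtRank (sqrt_half_pow_pos _)⟩

theorem HighlyEntangledOn.le_geometricMeasure (h : HighlyEntangledOn r f ψ.1) (hr : 2 ≤ r) :
    (r : ℝ) - 1 ≤ geometricMeasure ψ := by
  rw [← neg_logb_sqrt_half_pow hr]
  obtain ⟨L, -, -, hL⟩ := h.exists_block hr
  exact hL.le_geometricMeasure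

theorem HighlyEntangledOn.le_schmidtMeasure (h : HighlyEntangledOn r f ψ.1) (hr : 2 ≤ r) :
    (r : ℝ) - 1 ≤ schmidtMeasure ψ := by
  rw [← neg_logb_sqrt_half_pow hr]
  obtain ⟨L, -, -, hL⟩ := h.exists_block hr
  exact hL.le_schmidtMeasure (sqrt_half_pow_pos _)

end LowerBounds

/-- A measure that is large on highly entangled states cannot scale logarithmically on a universal
resource. -/
theorem ScalesAtMostLog.not_isSpatiallyEfficientUniversal {E : ∀ {N : ℕ}, QState N → ℝ}
    {Ψ : Resource} (h : ScalesAtMostLog E Ψ)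
    (hE : ∀ {r N : ℕ} {ψ : QState N} {f : Fin (gridSize r) ↪ Fin N},
      HighlyEntangledOn r f ψ.1 → 2 ≤ r → (r : ℝ) - 1 ≤ E ψ) :
    ¬ IsSpatiallyEfficientUniversal Ψ := by
  obtain ⟨C, N₀, h⟩ := h
  exact not_isSpatiallyEfficientUniversal_of_bound C N₀ fun r N ψ f hψ hr hN hent =>
    (hE hent hr).trans (h N ψ hψ hN)

theorem BlockEntropyLog.not_isSpatiallyEfficientUniversal {Ψ : Resource}
    (h : BlockEntropyLog Ψ) : ¬ IsSpatiallyEfficientUniversal Ψ := by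
  obtain ⟨C, h⟩ := h
  refine not_isSpatiallyEfficientUniversal_of_bound (|C| + 1) 0 fun r N ψ f hψ hr _ hent => ?_
  obtain ⟨L, hL2, hLN, hL⟩ := hent.exists_block hr
  have h1 := hL.le_entanglementEntropy
  rw [neg_logb_sqrt_half_pow hr] at h1
  exact h1.trans ((h N ψ hψ 0 L hL2 (by omega)).trans
    (mul_log_le_mul_log_of_le (by omega) hLN))

theorem exists_ghz_family : ∃ φ : ∀ n : ℕ, QState n, PolyPreparable φ ∧
    ∀ n, ∃ c : ℂ, ∀ x, (φ (n + 1)).1 x = if ∀ k, x k = x 0 then c else 0 := by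
  choose gates c hlen hout using exists_circuit_ghz
  refine ⟨fun n => match n with
    | 0 => ⟨circuitOutput [], norm_circuitOutput []⟩
    | n + 1 => ⟨circuitOutput (gates n), norm_circuitOutput _⟩,
    ⟨2 * Polynomial.X, fun n hn => ?_⟩, fun n => ⟨c n, hout n⟩⟩
  obtain ⟨n, rfl⟩ := Nat.exists_eq_succ_of_ne_zero (by omega : n ≠ 0)
  exact ⟨gates n, by simpa using hlen n, rfl⟩

/-- With GHZ targets on `n` qubits, `n ≤ numLE ψ ≤ C log N` and `N ≤ p n`, which fails for large
`n`. -/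
theorem not_isSpatiallyEfficientUniversal_of_numLE {Ψ : Resource}
    (h : ScalesAtMostLog (fun ψ => (numLE ψ : ℝ)) Ψ) : ¬ IsSpatiallyEfficientUniversal Ψ := by
  intro hΨ
  obtain ⟨C, N₀, h⟩ := h
  obtain ⟨φ, hφ, hghz⟩ := exists_ghz_family
  obtain ⟨p, hp⟩ := hΨ φ hφ
  obtain ⟨n, hn, hn2⟩ := ((eventually_mul_log_eval_lt (C := |C| + 1) (by positivity) p).and
    (Filter.eventually_ge_atTop (max 1 N₀))).exists
  obtain ⟨m, rfl⟩ := Nat.exists_eq_succ_of_ne_zero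
    (Nat.one_le_iff_ne_zero.mp ((le_max_left _ _).trans hn2))
  obtain ⟨N, ψ, f, hψ, hN, hconv⟩ := hp (m + 1) (by omega)
  obtain ⟨c, hc⟩ := hghz m
  have hle : m + 1 ≤ N := by simpa using Fintype.card_le_of_embedding f
  have h1 := h N ψ hψ (((le_max_right _ _).trans hn2).trans hle)
  have h2 : ((m + 1 : ℕ) : ℝ) ≤ numLE ψ := by
    exact_mod_cast le_numLE_of_convertible c hc hconv
  have h3 := mul_log_le_mul_log_of_le (C := C) (by omega) hN
  simp only [Nat.succ_eq_add_one] at hn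
  linarith

end MQC

end

theorem mainTheorem8 :
    (∀ Ψ : MQC.Resource,
      (MQC.ScalesAtMostLog MQC.entropicWidth Ψ ∨
        MQC.ScalesAtMostLog MQC.schmidtRankWidth Ψ ∨
        MQC.ScalesAtMostLog (fun ψ => (MQC.numLE ψ : ℝ)) Ψ ∨
        MQC.ScalesAtMostLog MQC.geometricMeasure Ψ ∨
        MQC.ScalesAtMostLog MQC.schmidtMeasure Ψ) →
      ¬ MQC.IsEfficientUniversal Ψ ∧ ¬ MQC.IsSpatiallyEfficientUniversal Ψ) ∧
    (∀ Ψ : MQC.Resource, MQC.BlockEntropyLog Ψ →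
      ¬ MQC.IsEfficientUniversal Ψ ∧ ¬ MQC.IsSpatiallyEfficientUniversal Ψ) ∧
    (¬ MQC.IsEfficientUniversal MQC.wResource ∧
      ¬ MQC.IsSpatiallyEfficientUniversal MQC.wResource) := by
  -- Refuting the spatial notion suffices, because forgetting the bounds on the program turns
  -- efficient universality into it.
  have both : ∀ Ψ : MQC.Resource, ¬ MQC.IsSpatiallyEfficientUniversal Ψ →
      ¬ MQC.IsEfficientUniversal Ψ ∧ ¬ MQC.IsSpatiallyEfficientUniversal Ψ :=
    fun Ψ h => ⟨fun h' => h h'.isSpatiallyEfficientUniversal, h⟩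
  refine ⟨fun Ψ h => both Ψ ?_, fun Ψ h => both Ψ h.not_isSpatiallyEfficientUniversal,
    both _ (MQC.scalesAtMostLog_schmidtMeasure_wResource.not_isSpatiallyEfficientUniversal
      fun h hr => h.le_schmidtMeasure hr)⟩
  rcases h with h | h | h | h | h
  · exact h.not_isSpatiallyEfficientUniversal fun h hr => h.le_entropicWidth hr
  · exact h.not_isSpatiallyEfficientUniversal fun h hr => h.le_schmidtRankWidth hr
  · exact MQC.not_isSpatiallyEfficientUniversal_of_numLE h
  · exact h.not_isSpatiallyEfficientUniversal fun h hr => h.le_geometricMeasure hr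
  · exact h.not_isSpatiallyEfficientUniversal fun h hr => h.le_schmidtMeasure hr
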